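/- **Setting.** All degrees lie in $[0,1]$; $\wedge$ is minimum. A fuzzy OSF signature consists of a finite set $\mathcal S$ of sorts, a set $\mathcal F$ of features, and a function $\preceq:\mathcal S\times\mathcal S\to[0,1]$ making $\mathcal S$ a fuzzy bounded lattice: $\preceq(s,s)=1$; $\preceq(s,s'')\ge\ \preceq(s,s')\wedge\preceq(s',s'')$; if $\preceq(s,s')>0$ and $\preceq(s',s)>0$ then $s=s'$; any two sorts $s,s'$ have a greatest lower bound $s\curlywedge s'$ for the relation $\preceq(\cdot,\cdot)>0$; and there are sorts $\bot,\top$ with $\preceq(\bot,s)=1=\ \preceq(s,\top)$ for all $s$. Let $\mathcal V$ be a countably infinite set of tags. **Terms.** OSF terms are defined recursively: $t=X:s(f_1\to t_1,\dots,f_n\to t_n)$ with $n\ge 0$, $X\in\mathcal V$ (the root tag of $t$), $s\in\mathcal S$, $f_i\in\mathcal F$ and $t_i$ OSF terms (for $n=0$ this is $X:s$). $\mathrm{Tags}(t)$ is the set of tags occurring in $t$. The term $t$ is normal if $s\ne\bot$, the $f_i$ are pairwise distinct, each $t_i$ is normal, and every $Y\in\mathrm{Tags}(t)$ has at most one occurrence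 in $t$ as the root tag of a subterm different from $Y:\top$. For a normal term $\psi$ and $X\in\mathrm{Tags}(\psi)$, $\mathrm{Sort}_\psi(X)$ is the most specific sort $s$ such that $X:s$ appears in $\psi$, and $X\xrightarrow{f}_\psi Y$ means that a feature $f$ points from a subterm of $\psi$ with root tag $X$ to a subterm with root tag $Y$. **Semantics.** A fuzzy OSF interpretation $\mathcal I$ is a set $\Delta$ with functions $s^{\mathcal I}:\Delta\to[0,1]$ ($s\in\mathcal S$) and $f^{\mathcal I}:\Delta\to\Delta$ ($f\in\mathcal F$) such that $\top^{\mathcal I}=1$, $\bot^{\mathcal I}=0$, $s^{\mathcal I}(d)\wedge\preceq(s,s')\le s'^{\mathcal I}(d)$, and $s^{\mathcal I}(d)\wedge s'^{\mathcal I}(d)>0$ implies $(s\curlywedge s')^{\mathcal I}(d)>0$. For $\alpha:\mathcal V\to\Delta$ put $$[\![X:s(f_1\to t_1,\dots,f_n\to t_n)]\!]^{\mathcal I,\alpha}(d)=\mathbf 1_{\{\alpha(X)\}}(d)\wedge s^{\mathcal I}(d)\wedge\bigwedge_{i=1}^{n}[\![t_i]\!]^{\mathcal I,\alpha}(f_i^{\mathcal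 I}(d)),$$ and $[\![t]\!]^{\mathcal I}(d)=\sup_{\alpha}[\![t]\!]^{\mathcal I,\alpha}(d)$. Write $\psi_0\preceq_\beta\psi_1$ (semantic subsumption) if $$\beta=\sup\{b\in[0,1]\mid [\![\psi_0]\!]^{\mathcal I}(d)\wedge b\le[\![\psi_1]\!]^{\mathcal I}(d)\text{ for all interpretations }\mathcal I\text{ and all }d\in\Delta\}.$$ A $b$-morphism $\gamma:\mathcal I\to\mathcal J$ is a map of domains such that $\gamma(f^{\mathcal I}(d))=f^{\mathcal J}(\gamma(d))$ and $s^{\mathcal I}(d)\wedge b\le s^{\mathcal J}(\gamma(d))$ for all $f,s,d$. For $d\in\Delta$, $\mathcal I[d]$ denotes the subalgebra generated by $d$, i.e. the restriction of $\mathcal I$ to the smallest set containing $d$ and closed under all $f^{\mathcal I}$. **Graphs and equivalence.** An OSF graph is a finite rooted directed graph whose nodes are labelled by sorts different from $\bot$ and whose edges are labelled by features, with at most one outgoing edge per node and feature (edges with different features may join the same two nodes), all of whose nodes are reachable from the root. Its nodes are variables, which are the tags in $\mathcal V$ together with further new variables: for each feature $f$ and each OSF graph $g$ there is a new variable $Z_{f,g}\notin\mathcal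 V$ that is not a node of $g$, with $Z_{f,g}\neq Z_{f',g'}$ whenever $(f,g)\ne(f',g')$. The graph algebra $\mathcal G$ is the interpretation whose domain is the set of all OSF graphs, in which $s^{\mathcal G}(g)=\ \preceq(s_g,s)$ with $s_g$ the label of the root of $g$, and $f^{\mathcal G}(g)$ is the maximal connected subgraph of $g$ rooted at $Y$ if $g$ has an edge labelled $f$ from its root to $Y$, and otherwise the graph with the single node $Z_{f,g}$, labelled $\top$, and no edges. The graph $G(\psi)$ of a normal term $\psi$ has nodes $\mathrm{Tags}(\psi)$, the root tag of $\psi$ as root, labels $\mathrm{Sort}_\psi(X)$, and the edges $X\xrightarrow{f}_\psi Y$. Normal terms are equivalent, $\psi\equiv\psi'$, if, with $g=G(\psi)$ and $g'=G(\psi')$, there are $1$-morphisms $\gamma:\mathcal G[g]\to\mathcal G[g']$ with $\gamma(g)=g'$ and $\gamma':\mathcal G[g']\to\mathcal G[g]$ with $\gamma'(g')=g$. **Syntactic subsumption.** A normal term $\psi_0$ is syntactically subsumed by a normal term $\psi_1$ with degree $\beta$, written $\psi_0\trianglelefteq_\beta\psi_1$, if there is a map $h:\mathrm{Tags}(\psi_1)\to\mathrm{Tags}(\psi_0)$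 that sends the root tag of $\psi_1$ to the root tag of $\psi_0$, such that $X\xrightarrow{f}_{\psi_1}Y$ implies $h(X)\xrightarrow{f}_{\psi_0}h(Y)$, and $$\beta=\min\{\preceq(\mathrm{Sort}_{\psi_0}(h(X)),\mathrm{Sort}_{\psi_1}(X))\mid X\in\mathrm{Tags}(\psi_1)\}.$$ **Theorem** (Semantic and syntactic subsumption). Let $\psi_0,\psi_1$ be normal OSF terms and let $\beta\in(0,1]$. Then $\psi_0\preceq_\beta\psi_1$ if and only if there are normal OSF terms $\psi_0',\psi_1'$ such that $\psi_0\equiv\psi_0'$, $\psi_1\equiv\psi_1'$ and $\psi_0'\trianglelefteq_\beta\psi_1'$. -/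

import Mathlib

universe u

namespace FuzzyOSF

noncomputable section

open scoped Classical

/-! ### Fuzzy orders and fuzzy finite bounded lattices -/

/-- A fuzzy partial order: fuzzy reflexivity, max-min transitivity and strong antisymmetry. -/
structure IsFuzzyPartialOrder {S : Type u} (R : S → S → unitInterval) : Prop where
  refl : ∀ x, R x x = 1
  trans : ∀ x y z, min (R x y) (R y z) ≤ R x z
  antisymm : ∀ x y, 0 < R x y → 0 < R y x → x = y

/-- `c` is a fuzzy lower bound of the set `A`. -/
def IsFuzzyLowerBound {S : Type u} (R : S → S → unitInterval) (A : Set S) (c : S) : Prop :=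
  ∀ a ∈ A, 0 < R c a

/-- `c` is the greatest fuzzy lower bound of the set `A`. -/
def IsFuzzyGLB {S : Type u} (R : S → S → unitInterval) (A : Set S) (c : S) : Prop :=
  IsFuzzyLowerBound R A c ∧ ∀ c', IsFuzzyLowerBound R A c' → 0 < R c' c

/-- A fuzzy finite bounded lattice on the set `S` of sort symbols.  Together with a type `F` of
feature symbols this is a fuzzy OSF signature. -/
structure SortLattice (S : Type u) where
  sub : S → S → unitInterval
  finite : Finite S
  partialOrder : IsFuzzyPartialOrder sub
  exists_glb : ∀ a b : S, ∃ c, IsFuzzyGLB sub {a, b} c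
  bot : S
  top : S
  bot_sub : ∀ s, sub bot s = 1
  sub_top : ∀ s, sub s top = 1

/-- The greatest common subsort of two sorts. -/
def SortLattice.glb {S : Type u} (L : SortLattice S) (a b : S) : S :=
  Classical.choose (L.exists_glb a b)

theorem SortLattice.glb_spec {S : Type u} (L : SortLattice S) (a b : S) :
    IsFuzzyGLB L.sub {a, b} (L.glb a b) :=
  Classical.choose_spec (L.exists_glb a b)

theorem SortLattice.eq_bot {S : Type u} (L : SortLattice S) {s : S} (h : 0 < L.sub s L.bot) :
    s = L.bot :=
  L.partialOrder.antisymm _ _ h (by rw [L.bot_sub]; exact zero_lt_one)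

theorem SortLattice.top_ne_bot {S : Type u} (L : SortLattice S) {s : S} (h : s ≠ L.bot) :
    L.top ≠ L.bot := by
  intro e
  apply h
  apply L.eq_bot
  rw [← e, L.sub_top]
  exact zero_lt_one

/-! ### OSF terms -/

/-- `mk X s n f t` is the OSF term `X : s (f 0 → t 0, …, f (n-1) → t (n-1))`; the case `n = 0` is
the sorted variable `X : s`. -/
inductive Term (V S F : Type u) : Type u
  | mk (X : V) (s : S) (n : ℕ) (f : Fin n → F) (t : Fin n → Term V S F) : Term V S F

namespace Term

variable {V S F : Type u}

/-- The root tag. -/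
def rootTag : Term V S F → V
  | mk X _ _ _ _ => X

/-- The set of tags occurring in a term. -/
def tags : Term V S F → Set V
  | mk X _ _ _ t => {X} ∪ ⋃ i, (t i).tags

/-- `t.HasSort X s`: the expression `X : s` appears in `t`. -/
def HasSort : Term V S F → V → S → Prop
  | mk Y s' _ _ t, X, s => (Y = X ∧ s' = s) ∨ ∃ i, (t i).HasSort X s

/-- `t.Edge X f Y`: a feature `f` points from a subterm of `t` with root tag `X` to a subterm of
`t` with root tag `Y`. -/
def Edge : Term V S F → V → F → V → Prop
  | mk Z _ _ g t, X, f, Y =>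
      (Z = X ∧ ∃ i, g i = f ∧ (t i).rootTag = Y) ∨ ∃ i, (t i).Edge X f Y

/-- The number of occurrences of the tag `Y` in a term at which `Y` is the root tag of a subterm
different from `Y : ⊤`. -/
def properOccurrences (top : S) (Y : V) : Term V S F → ℕ
  | mk X s n _ t =>
      (if X = Y ∧ ¬ (s = top ∧ n = 0) then 1 else 0) + ∑ i, (t i).properOccurrences top Y

/-- OSF terms in normal form (ψ-terms). -/
def Normal (L : SortLattice S) : Term V S F → Prop
  | mk X s n f t =>
      s ≠ L.bot ∧ Function.Injective f ∧ (∀ i, (t i).Normal L) ∧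
        ∀ Y ∈ (mk X s n f t).tags, (mk X s n f t).properOccurrences L.top Y ≤ 1

/-- `s` is the most specific sort such that `X : s` appears in `t`. -/
def IsMostSpecificSort (L : SortLattice S) (t : Term V S F) (X : V) (s : S) : Prop :=
  t.HasSort X s ∧ ∀ s', t.HasSort X s' → 0 < L.sub s s'

/-- `Sort_t(X)`, the most specific sort `s` such that `X : s` appears in `t`.  It exists whenever
`t` is normal and `X` is a tag of `t`; the value is `⊤` when there is no such sort. -/
def sortOf (L : SortLattice S) (t : Term V S F) (X : V) : S :=
  if h : ∃ s, t.IsMostSpecificSort L X s then Classical.choose h else L.top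

end Term

/-! ### OSF interpretations and denotations of terms -/

/-- A fuzzy OSF interpretation (OSF algebra). -/
structure Interp {S : Type u} (L : SortLattice S) (F : Type u) where
  Dom : Type u
  sort : S → Dom → unitInterval
  feat : F → Dom → Dom
  sort_top : ∀ d, sort L.top d = 1
  sort_bot : ∀ d, sort L.bot d = 0
  sort_sub : ∀ s₀ s₁ d, min (sort s₀ d) (L.sub s₀ s₁) ≤ sort s₁ d
  sort_glb : ∀ s₀ s₁ d, 0 < min (sort s₀ d) (sort s₁ d) → 0 < sort (L.glb s₀ s₁) d

section Semantics

variable {V S F : Type u} {L : SortLattice S}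

/-- The denotation of a term under an assignment. -/
def denoteAt (I : Interp L F) (α : V → I.Dom) : Term V S F → I.Dom → unitInterval
  | .mk X s _ f t, d =>
      min (min (if d = α X then 1 else 0) (I.sort s d))
        (⨅ i, denoteAt I α (t i) (I.feat (f i) d))

/-- The denotation of a term: the union over all assignments. -/
def denote (I : Interp L F) (t : Term V S F) (d : I.Dom) : unitInterval :=
  ⨆ α : V → I.Dom, denoteAt I α t d

/-- The degree of semantic subsumption of `t₁` by `t₂`. -/
def semSub (L : SortLattice S) (t₁ t₂ : Term V S F) : unitInterval :=
  sSup {β | ∀ (I : Interp L F) (d : I.Dom), min (denote I t₁ d) β ≤ denote I t₂ d}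

/-- The function `w^I` for a word of features `w = f₁ … fₙ`: apply `f₁` first and `fₙ` last. -/
def Interp.word (I : Interp L F) (w : List F) (d : I.Dom) : I.Dom :=
  w.foldl (fun d f => I.feat f d) d

/-- The closure of `D` under feature application. -/
def Interp.closure (I : Interp L F) (D : Set I.Dom) : Set I.Dom :=
  ⋃ w : List F, I.word w '' D

theorem Interp.feat_mem_closure (I : Interp L F) (D : Set I.Dom) (f : F) {d : I.Dom}
    (h : d ∈ I.closure D) : I.feat f d ∈ I.closure D := by
  obtain ⟨w, d', hd', rfl⟩ := Set.mem_iUnion.1 h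
  exact Set.mem_iUnion.2 ⟨w ++ [f], d', hd', by simp [Interp.word]⟩

theorem Interp.mem_closure_singleton (I : Interp L F) (d : I.Dom) : d ∈ I.closure {d} :=
  Set.mem_iUnion.2 ⟨[], d, rfl, rfl⟩

/-- The subalgebra generated by `D`. -/
def Interp.generated (I : Interp L F) (D : Set I.Dom) : Interp L F where
  Dom := I.closure D
  sort s d := I.sort s d
  feat f d := ⟨I.feat f d, I.feat_mem_closure D f d.2⟩
  sort_top d := I.sort_top d
  sort_bot d := I.sort_bot d
  sort_sub s₀ s₁ d := I.sort_sub s₀ s₁ d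
  sort_glb s₀ s₁ d := I.sort_glb s₀ s₁ d

/-- `d` as an element of the subalgebra it generates. -/
def Interp.gen (I : Interp L F) (d : I.Dom) : (I.generated {d}).Dom :=
  ⟨d, I.mem_closure_singleton d⟩

/-- `γ` is a `β`-homomorphism. -/
def IsMorphism (β : unitInterval) (I J : Interp L F) (γ : I.Dom → J.Dom) : Prop :=
  (∀ f d, γ (I.feat f d) = J.feat f (γ d)) ∧
    ∀ s d, min (I.sort s d) β ≤ J.sort s (γ d)

end Semantics

/-! ### OSF graphs -/

/-- OSF graphs with nodes in `W`.  A triple `(x, f, y)` in `edges` is an edge from `x` to `y`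
labelled `f`.  Node labels are only meaningful on `nodes`; elsewhere `label` has the conventional
value `⊤`, so that equality of graphs is not affected. -/
@[ext]
structure OSFGraph {S : Type u} (L : SortLattice S) (F W : Type u) where
  nodes : Set W
  root : W
  label : W → S
  edges : Set (W × F × W)
  finite_nodes : nodes.Finite
  finite_edges : edges.Finite
  root_mem : root ∈ nodes
  src_mem : ∀ x f y, (x, f, y) ∈ edges → x ∈ nodes
  tgt_mem : ∀ x f y, (x, f, y) ∈ edges → y ∈ nodes
  label_ne_bot : ∀ x ∈ nodes, label x ≠ L.bot
  label_off : ∀ x, x ∉ nodes → label x = L.top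
  functional : ∀ x f y z, (x, f, y) ∈ edges → (x, f, z) ∈ edges → y = z
  reachable : ∀ x ∈ nodes, Relation.ReflTransGen (fun a b => ∃ f, (a, f, b) ∈ edges) root x

namespace OSFGraph

variable {S F W : Type u} {L : SortLattice S}

/-- The nodes of `g` reachable from `y` by a directed path. -/
def reach (g : OSFGraph L F W) (y : W) : Set W :=
  {x | Relation.ReflTransGen (fun a b => ∃ f, (a, f, b) ∈ g.edges) y x}

theorem reach_subset (g : OSFGraph L F W) {y : W} (hy : y ∈ g.nodes) : g.reach y ⊆ g.nodes := by
  intro x hx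
  induction hx with
  | refl => exact hy
  | tail _ h _ => obtain ⟨f, hf⟩ := h; exact g.tgt_mem _ _ _ hf

/-- The maximal connected subgraph of `g` rooted at the node `y`. -/
def subgraphAt (g : OSFGraph L F W) (y : W) (hy : y ∈ g.nodes) : OSFGraph L F W where
  nodes := g.reach y
  root := y
  label x := if x ∈ g.reach y then g.label x else L.top
  edges := {e ∈ g.edges | e.1 ∈ g.reach y}
  finite_nodes := g.finite_nodes.subset (g.reach_subset hy)
  finite_edges := g.finite_edges.subset fun _ h => h.1
  root_mem := Relation.ReflTransGen.refl
  src_mem _ _ _ h := h.2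
  tgt_mem _ f _ h := Relation.ReflTransGen.tail h.2 ⟨f, h.1⟩
  label_ne_bot x hx := by
    rw [if_pos hx]
    exact g.label_ne_bot x (g.reach_subset hy hx)
  label_off x hx := if_neg hx
  functional x f a b h h' := g.functional x f a b h.1 h'.1
  reachable x hx := by
    induction hx with
    | refl => exact Relation.ReflTransGen.refl
    | tail h₁ h₂ ih =>
      obtain ⟨f, hf⟩ := h₂
      exact Relation.ReflTransGen.tail ih ⟨f, hf, h₁⟩

/-- The graph with the single node `z`, labelled `⊤`, and no edges. -/
def trivial (L : SortLattice S) (F : Type u) (hL : L.top ≠ L.bot) (z : W) : OSFGraph L F W where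
  nodes := {z}
  root := z
  label _ := L.top
  edges := ∅
  finite_nodes := Set.finite_singleton z
  finite_edges := Set.finite_empty
  root_mem := rfl
  src_mem _ _ _ h := h.elim
  tgt_mem _ _ _ h := h.elim
  label_ne_bot _ _ := hL
  label_off _ _ := rfl
  functional _ _ _ _ h := h.elim
  reachable _ hx := by rw [Set.mem_singleton_iff.1 hx]

theorem top_ne_bot (g : OSFGraph L F W) : L.top ≠ L.bot :=
  L.top_ne_bot (g.label_ne_bot g.root g.root_mem)

end OSFGraph

/-! ### The OSF graph algebra -/

/-- Variables used as nodes of OSF graphs: the tags of terms and, in addition, new variables.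
A new variable records a feature and the data (root, nodes with their labels, labelled edges) of a
finite graph, so that it is determined by, and determines, the feature and the graph. -/
inductive Node (V S F : Type u) : Type u
  | tag (v : V) : Node V S F
  | fresh (f : F) (root : Node V S F) (n : ℕ) (nodes : Fin n → Node V S F) (labels : Fin n → S)
      (m : ℕ) (src : Fin m → Node V S F) (feat : Fin m → F) (tgt : Fin m → Node V S F) :
      Node V S F

section GraphAlgebra

variable {V S F : Type u} {L : SortLattice S}

/-- An enumeration of the nodes of a graph. -/
def OSFGraph.nodeList {W : Type u} (g : OSFGraph L F W) : List W := g.finite_nodes.toFinset.toList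

/-- An enumeration of the edges of a graph. -/
def OSFGraph.edgeList {W : Type u} (g : OSFGraph L F W) : List (W × F × W) :=
  g.finite_edges.toFinset.toList

/-- The new variable `Z_{f,g}` determined by the feature `f` and the graph `g`. -/
def newNode (f : F) (g : OSFGraph L F (Node V S F)) : Node V S F :=
  .fresh f g.root
    g.nodeList.length (fun i => g.nodeList.get i) (fun i => g.label (g.nodeList.get i))
    g.edgeList.length (fun i => (g.edgeList.get i).1) (fun i => (g.edgeList.get i).2.1)
    (fun i => (g.edgeList.get i).2.2)

theorem ofFn_eq_of_heq {α : Type u} {n m : ℕ} {a : Fin n → α} {b : Fin m → α} (h : n = m)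
    (h' : HEq a b) : List.ofFn a = List.ofFn b := by
  subst h
  rw [eq_of_heq h']

/-- If `f ≠ f'` or `g ≠ g'` then `Z_{f,g} ≠ Z_{f',g'}`. -/
theorem newNode_injective {f f' : F} {g g' : OSFGraph L F (Node V S F)}
    (h : newNode f g = newNode f' g') : f = f' ∧ g = g' := by
  simp only [newNode, Node.fresh.injEq] at h
  obtain ⟨hf, hr, hn, hno, hla, hm, hs, hfe, ht⟩ := h
  refine ⟨hf, ?_⟩
  have e1 : g.nodeList = g'.nodeList := by
    have := ofFn_eq_of_heq hn hno
    simpa only [List.get_eq_getElem, List.ofFn_getElem] using this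
  have e2 : g.nodeList.map g.label = g'.nodeList.map g'.label := by
    have := ofFn_eq_of_heq hn hla
    simpa only [List.get_eq_getElem, List.ofFn_getElem_eq_map] using this
  have e3 : g.edgeList = g'.edgeList := by
    have a1 := ofFn_eq_of_heq hm hs
    have a2 := ofFn_eq_of_heq hm hfe
    have a3 := ofFn_eq_of_heq hm ht
    apply List.ext_getElem hm
    intro i h1 h2
    have b1 := congrArg (fun l => l[i]?) a1
    have b2 := congrArg (fun l => l[i]?) a2
    have b3 := congrArg (fun l => l[i]?) a3
    simp [h1, h2] at b1 b2 b3
    exact Prod.ext b1 (Prod.ext b2 b3)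
  have n1 : g.nodes = g'.nodes := by
    ext x
    have : x ∈ g.nodeList ↔ x ∈ g'.nodeList := by rw [e1]
    simpa [OSFGraph.nodeList] using this
  have n3 : g.edges = g'.edges := by
    ext x
    have : x ∈ g.edgeList ↔ x ∈ g'.edgeList := by rw [e3]
    simpa [OSFGraph.edgeList] using this
  have n2 : g.label = g'.label := by
    funext x
    by_cases hx : x ∈ g.nodes
    · rw [← e1] at e2
      exact List.map_inj_left.1 e2 x (by simpa [OSFGraph.nodeList] using hx)
    · rw [g.label_off x hx, g'.label_off x (n1 ▸ hx)]
  exact OSFGraph.ext n1 hr n2 n3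

theorem Node.ne_fresh (x : Node V S F) : ∀ f r n nodes labels m src feat tgt,
    x = .fresh f r n nodes labels m src feat tgt → ∀ i, nodes i ≠ x := by
  induction x with
  | tag v => intro f r n nodes labels m src feat tgt h; cases h
  | fresh f r n nodes labels m src feat tgt _ ih _ _ =>
    intro f' r' n' nodes' labels' m' src' feat' tgt' h i hi
    cases h
    exact ih i _ _ _ _ _ _ _ _ _ hi i rfl

/-- The variable `Z_{f,g}` is not a node of `g`. -/
theorem newNode_notMem (f : F) (g : OSFGraph L F (Node V S F)) : newNode f g ∉ g.nodes := by
  intro h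
  have h' : newNode f g ∈ g.nodeList := by simpa [OSFGraph.nodeList] using h
  obtain ⟨i, hi⟩ := List.get_of_mem h'
  exact Node.ne_fresh (newNode f g) _ _ _ _ _ _ _ _ _ rfl i hi

/-- Feature application in the graph algebra. -/
def graphFeat (f : F) (g : OSFGraph L F (Node V S F)) : OSFGraph L F (Node V S F) :=
  if h : ∃ y, (g.root, f, y) ∈ g.edges then
    g.subgraphAt (Classical.choose h) (g.tgt_mem _ _ _ (Classical.choose_spec h))
  else OSFGraph.trivial L F g.top_ne_bot (newNode f g)

/-- The fuzzy OSF graph algebra. -/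
def graphAlgebra (V : Type u) {S : Type u} (L : SortLattice S) (F : Type u) : Interp L F where
  Dom := OSFGraph L F (Node V S F)
  sort s g := L.sub (g.label g.root) s
  feat := graphFeat
  sort_top _ := L.sub_top _
  sort_bot g := by
    by_contra h
    exact g.label_ne_bot g.root g.root_mem (L.eq_bot (unitInterval.pos_iff_ne_zero.2 h))
  sort_sub _ _ _ := L.partialOrder.trans _ _ _
  sort_glb s₀ s₁ g h := by
    refine (L.glb_spec s₀ s₁).2 _ ?_
    rintro a (rfl | rfl)
    · exact (lt_min_iff.1 h).1
    · exact (lt_min_iff.1 h).2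

/-- Equivalence of OSF graphs. -/
def GraphEquiv (g₀ g₁ : OSFGraph L F (Node V S F)) : Prop :=
  let G := graphAlgebra V L F
  (∃ γ : (G.generated {g₀}).Dom → (G.generated {g₁}).Dom,
      IsMorphism 1 (G.generated {g₀}) (G.generated {g₁}) γ ∧ γ (G.gen g₀) = G.gen g₁) ∧
    ∃ γ : (G.generated {g₁}).Dom → (G.generated {g₀}).Dom,
      IsMorphism 1 (G.generated {g₁}) (G.generated {g₀}) γ ∧ γ (G.gen g₁) = G.gen g₀

end GraphAlgebra

/-! ### The graph of a normal term -/

namespace Term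

variable {V S F : Type u} {L : SortLattice S}

theorem rootTag_mem_tags (t : Term V S F) : t.rootTag ∈ t.tags := by
  cases t with
  | mk X s n f t => exact Or.inl rfl

theorem finite_tags (t : Term V S F) : t.tags.Finite := by
  induction t with
  | mk X s n f t ih => exact (Set.finite_singleton X).union (Set.finite_iUnion ih)

theorem edge_mem_tags (t : Term V S F) {X : V} {f : F} {Y : V} (h : t.Edge X f Y) :
    X ∈ t.tags ∧ Y ∈ t.tags := by
  induction t with
  | mk Z s n g t ih =>
    rcases h with ⟨rfl, i, -, rfl⟩ | ⟨i, hi⟩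
    · exact ⟨Or.inl rfl, Or.inr (Set.mem_iUnion.2 ⟨i, rootTag_mem_tags _⟩)⟩
    · exact ⟨Or.inr (Set.mem_iUnion.2 ⟨i, (ih i hi).1⟩),
        Or.inr (Set.mem_iUnion.2 ⟨i, (ih i hi).2⟩)⟩

theorem finite_edges (t : Term V S F) : {e : V × F × V | t.Edge e.1 e.2.1 e.2.2}.Finite := by
  induction t with
  | mk Z s n g t ih =>
    refine Set.Finite.subset ((Set.finite_range fun i => (Z, g i, (t i).rootTag)).union
      (Set.finite_iUnion ih)) ?_
    rintro ⟨X, f, Y⟩ (⟨rfl, i, rfl, rfl⟩ | ⟨i, hi⟩)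
    · exact Or.inl ⟨i, rfl⟩
    · exact Or.inr (Set.mem_iUnion.2 ⟨i, hi⟩)

theorem properOccurrences_pos (top : S) (t : Term V S F) {X : V} {f : F} {Y : V}
    (h : t.Edge X f Y) : 1 ≤ t.properOccurrences top X := by
  induction t with
  | mk Z s n g t ih =>
    rw [properOccurrences]
    rcases h with ⟨rfl, i, -, rfl⟩ | ⟨i, hi⟩
    · have : ¬ (s = top ∧ n = 0) := by
        rintro ⟨-, rfl⟩
        exact i.elim0
      simp [this]
    · have h1 := Finset.single_le_sum (f := fun i => (t i).properOccurrences top X)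
        (fun i _ => Nat.zero_le _) (Finset.mem_univ i)
      have h2 := ih i hi
      omega

theorem edge_functional_aux (t : Term V S F) (ht : t.Normal L) {X : V} {f : F} {Y Z : V}
    (hX : t.properOccurrences L.top X ≤ 1) (h : t.Edge X f Y) (h' : t.Edge X f Z) : Y = Z := by
  induction t with
  | mk W s n g t ih =>
    rw [properOccurrences] at hX
    have key : ∀ i, (t i).properOccurrences L.top X ≤
        ∑ j, (t j).properOccurrences L.top X := fun i =>
      Finset.single_le_sum (f := fun i => (t i).properOccurrences L.top X)
        (fun i _ => Nat.zero_le _) (Finset.mem_univ i)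
    have key0 : ∀ i : Fin n, W = X → ∀ j Y', (t j).Edge X f Y' → False := by
      rintro i rfl j Y' hj
      have : ¬ (s = L.top ∧ n = 0) := by
        rintro ⟨-, rfl⟩
        exact i.elim0
      rw [if_pos ⟨rfl, this⟩] at hX
      have h1 := key j
      have h2 := properOccurrences_pos L.top (t j) hj
      omega
    rcases h with ⟨e, i, hi, rfl⟩ | ⟨i, hi⟩
    · rcases h' with ⟨e', j, hj, rfl⟩ | ⟨j, hj⟩
      · rw [ht.2.1 (hi.trans hj.symm)]
      · exact (key0 i e j _ hj).elim
    · rcases h' with ⟨e', j, hj, rfl⟩ | ⟨j, hj⟩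
      · exact (key0 j e' i _ hi).elim
      · by_cases hij : i = j
        · subst hij
          exact ih i (ht.2.2.1 i) (by have := key i; omega) hi hj
        · have h1 := Finset.sum_le_sum_of_subset (f := fun i => (t i).properOccurrences L.top X)
            (Finset.subset_univ {i, j})
          rw [Finset.sum_pair hij] at h1
          have h2 := properOccurrences_pos L.top (t i) hi
          have h3 := properOccurrences_pos L.top (t j) hj
          omega

theorem edge_functional (t : Term V S F) (ht : t.Normal L) {X : V} {f : F} {Y Z : V}
    (h : t.Edge X f Y) (h' : t.Edge X f Z) : Y = Z := by
  refine edge_functional_aux t ht ?_ h h'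
  have hX := (t.edge_mem_tags h).1
  cases t with
  | mk W s n g t => exact ht.2.2.2 X hX

theorem ne_bot_of_hasSort (t : Term V S F) (ht : t.Normal L) {X : V} {s : S}
    (h : t.HasSort X s) : s ≠ L.bot := by
  induction t with
  | mk W s' n g t ih =>
    rcases h with ⟨-, rfl⟩ | ⟨i, hi⟩
    · exact ht.1
    · exact ih i (ht.2.2.1 i) hi

theorem mem_tags_of_hasSort (t : Term V S F) {X : V} {s : S} (h : t.HasSort X s) :
    X ∈ t.tags := by
  induction t with
  | mk W s' n g t ih =>
    rcases h with ⟨rfl, -⟩ | ⟨i, hi⟩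
    · exact Or.inl rfl
    · exact Or.inr (Set.mem_iUnion.2 ⟨i, ih i hi⟩)

theorem top_ne_bot_of_normal (t : Term V S F) (ht : t.Normal L) : L.top ≠ L.bot := by
  cases t with
  | mk W s n g t => exact L.top_ne_bot ht.1

theorem sortOf_ne_bot (t : Term V S F) (ht : t.Normal L) (X : V) : t.sortOf L X ≠ L.bot := by
  unfold sortOf
  split_ifs with h
  · exact t.ne_bot_of_hasSort ht (Classical.choose_spec h).1
  · exact t.top_ne_bot_of_normal ht

theorem sortOf_off (t : Term V S F) {X : V} (hX : X ∉ t.tags) : t.sortOf L X = L.top := by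
  unfold sortOf
  rw [dif_neg]
  rintro ⟨s, hs⟩
  exact hX (t.mem_tags_of_hasSort hs.1)

theorem reachable_tags (t : Term V S F) {X : V} (hX : X ∈ t.tags) :
    Relation.ReflTransGen (fun a b => ∃ f, t.Edge a f b) t.rootTag X := by
  induction t with
  | mk W s n g t ih =>
    rcases hX with rfl | hX
    · exact Relation.ReflTransGen.refl
    · obtain ⟨i, hi⟩ := Set.mem_iUnion.1 hX
      refine Relation.ReflTransGen.head (b := (t i).rootTag) ⟨g i, Or.inl ⟨rfl, i, rfl, rfl⟩⟩ ?_
      refine Relation.ReflTransGen.mono ?_ _ _ (ih i hi)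
      rintro a b ⟨f, hf⟩
      exact ⟨f, Or.inr ⟨i, hf⟩⟩

/-- The OSF graph `G(t)` of a normal term `t`: its nodes are the tags of `t`, labelled by their
most specific sorts, and its edges are the feature edges of `t`. -/
def graph (L : SortLattice S) (t : Term V S F) (ht : t.Normal L) :
    OSFGraph L F (Node V S F) where
  nodes := Node.tag '' t.tags
  root := .tag t.rootTag
  label
    | .tag v => t.sortOf L v
    | .fresh _ _ _ _ _ _ _ _ _ => L.top
  edges := (fun e => (Node.tag e.1, e.2.1, Node.tag e.2.2)) ''
    {e : V × F × V | t.Edge e.1 e.2.1 e.2.2}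
  finite_nodes := t.finite_tags.image _
  finite_edges := t.finite_edges.image _
  root_mem := ⟨_, t.rootTag_mem_tags, rfl⟩
  src_mem := by
    rintro _ _ _ ⟨⟨X, f, Y⟩, h, e⟩
    cases e
    exact ⟨X, (t.edge_mem_tags h).1, rfl⟩
  tgt_mem := by
    rintro _ _ _ ⟨⟨X, f, Y⟩, h, e⟩
    cases e
    exact ⟨Y, (t.edge_mem_tags h).2, rfl⟩
  label_ne_bot := by
    rintro _ ⟨v, -, rfl⟩
    exact t.sortOf_ne_bot ht v
  label_off := by
    rintro (v | _) h
    · exact t.sortOf_off fun hv => h ⟨v, hv, rfl⟩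
    · rfl
  functional := by
    rintro _ _ _ _ ⟨⟨X, f, Y⟩, h, e⟩ ⟨⟨X', f', Z⟩, h', e'⟩
    cases e
    cases e'
    rw [t.edge_functional ht h h']
  reachable := by
    rintro _ ⟨v, hv, rfl⟩
    refine (t.reachable_tags hv).lift Node.tag ?_
    rintro a b ⟨f, hf⟩
    exact ⟨f, (a, f, b), hf, rfl⟩

end Term

section Subsumption

variable {V S F : Type u}

/-- Equivalence of normal terms: `ψ₀ ≡ ψ₁` when their graphs are equivalent. -/
def TermEquiv (L : SortLattice S) (ψ₀ ψ₁ : {t : Term V S F // t.Normal L}) : Prop :=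
  GraphEquiv (ψ₀.1.graph L ψ₀.2) (ψ₁.1.graph L ψ₁.2)

/-- `ψ₀ ≼_β ψ₁`: the degree of semantic subsumption of `ψ₀` by `ψ₁` is `β`. -/
def SemSubsumed (L : SortLattice S) (β : unitInterval)
    (ψ₀ ψ₁ : {t : Term V S F // t.Normal L}) : Prop :=
  semSub L ψ₀.1 ψ₁.1 = β

/-- `ψ₀` is syntactically subsumed by `ψ₁` with degree `β`. -/
def SynSubsumed (L : SortLattice S) (β : unitInterval)
    (ψ₀ ψ₁ : {t : Term V S F // t.Normal L}) : Prop :=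
  ∃ h : ψ₁.1.tags → ψ₀.1.tags,
    h ⟨ψ₁.1.rootTag, ψ₁.1.rootTag_mem_tags⟩ = ⟨ψ₀.1.rootTag, ψ₀.1.rootTag_mem_tags⟩ ∧
    (∀ (X Y : ψ₁.1.tags) (f : F), ψ₁.1.Edge X f Y → ψ₀.1.Edge (h X) f (h Y)) ∧
    IsLeast {b | ∃ X : ψ₁.1.tags, b = L.sub (ψ₀.1.sortOf L (h X)) (ψ₁.1.sortOf L X)} β

end Subsumption

end

end FuzzyOSF

namespace FuzzyOSF
open scoped Classical

variable {V S F : Type u} {L : SortLattice S}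

/-! For a positive degree `b`, a term has value at least `b` at `d` exactly when some assignment
sends its root tag to `d`, follows its features and respects its sorts to degree `b`
(`le_denote_iff`). Since every tag is reachable from the root, `d` determines the assignment on
tags, so the supremum over assignments is attained.

The subalgebra generated by `G(t)` is free in the sense that two words of features agreeing on
`G(t)` agree wherever `t` is satisfied: `word_eq_of_word_graph_eq`, which rests on the injectivity
of `Z_{f,g}`. Hence satisfying `t` at `d` to degree `b` amounts to a `b`-morphism from this
subalgebra sending `G(t)` to `d` (`le_denote_iff_morphism`), and equivalent terms have equal
denotations.

If `h` witnesses syntactic subsumption, assignments for the subsumed term composed with `h` satisfy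
the other term. Evaluation at the graph of the subsumed term, where the assignment is forced, shows
that the degree is exactly the minimum over tags.

Conversely, evaluating at `G(ψ₀)` gives an assignment of `ψ₁` by graphs, but some values may be
trivial graphs that correspond to no tag: `X : ⊤ (f → Y : ⊤)` denotes the constant `1` because
features are total, yet it need not map into a term without `f` at its root. The remedy is to add
leaves labelled `⊤` to `ψ₀`, which preserves equivalence, until every word leading to a tag of `ψ₁`
is a path in it. Then the assignment takes values at tags and yields `h`, and the other direction
identifies the degree as `β`. -/

/-! ### Assignments that satisfy a term -/

/-- `α` sends the root tag of `t` to `d`, is compatible with the features of `t` and respects all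
sorts of `t` to degree at least `b`. -/
structure Satisfies (I : Interp L F) (α : V → I.Dom) (b : unitInterval) (t : Term V S F)
    (d : I.Dom) : Prop where
  root : d = α t.rootTag
  edge : ∀ X f Y, t.Edge X f Y → I.feat f (α X) = α Y
  sort : ∀ X s, t.HasSort X s → b ≤ I.sort s (α X)

/-- Positivity of `b` is what turns the indicator factor, whose only values are `0` and `1`, into
the equation for the tag. -/
theorem le_denoteAt_iff (I : Interp L F) (α : V → I.Dom) {b : unitInterval} (hb : 0 < b)
    (t : Term V S F) (d : I.Dom) : b ≤ denoteAt I α t d ↔ Satisfies I α b t d := by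
  induction t generalizing d with
  | mk X s n g t ih =>
    have h0 : b ≤ (if d = α X then 1 else 0) ↔ d = α X := by
      split_ifs with h
      · simp [h, unitInterval.le_one']
      · simp [h, hb.ne']
    simp only [denoteAt, le_min_iff, le_iInf_iff, ih, h0]
    constructor
    · rintro ⟨⟨rfl, hs⟩, ht⟩
      refine ⟨rfl, ?_, ?_⟩
      · rintro _ _ _ (⟨rfl, i, rfl, rfl⟩ | ⟨i, hi⟩)
        · exact (ht i).root
        · exact (ht i).edge _ _ _ hi
      · rintro _ _ (⟨rfl, rfl⟩ | ⟨i, hi⟩)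
        · exact hs
        · exact (ht i).sort _ _ hi
    · rintro ⟨h1, h2, h3⟩
      change d = α X at h1
      subst h1
      refine ⟨⟨rfl, h3 _ _ (Or.inl ⟨rfl, rfl⟩)⟩, fun i => ⟨?_, ?_, ?_⟩⟩
      · exact h2 _ _ _ (Or.inl ⟨rfl, i, rfl, rfl⟩)
      · exact fun _ _ _ h => h2 _ _ _ (Or.inr ⟨i, h⟩)
      · exact fun _ _ h => h3 _ _ (Or.inr ⟨i, h⟩)

theorem Satisfies.mono {I : Interp L F} {α : V → I.Dom} {b b' : unitInterval} {t : Term V S F}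
    {d : I.Dom} (h : Satisfies I α b t d) (hb : b' ≤ b) : Satisfies I α b' t d :=
  ⟨h.root, h.edge, fun X s hs => hb.trans (h.sort X s hs)⟩

/-- Every tag is reached from the root by features, and these act as functions; the degrees play no
role. -/
theorem Satisfies.eqOn {I : Interp L F} {α α' : V → I.Dom} {b b' : unitInterval} {t : Term V S F}
    {d : I.Dom} (h : Satisfies I α b t d) (h' : Satisfies I α' b' t d) {X : V}
    (hX : X ∈ t.tags) : α X = α' X := by
  have := t.reachable_tags hX
  induction this with
  | refl => rw [← h.root, ← h'.root]
  | tail _ hf ih =>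
    obtain ⟨f, hf⟩ := hf
    rw [← h.edge _ _ _ hf, ← h'.edge _ _ _ hf, ih (t.edge_mem_tags hf).1]

theorem le_denote_iff (I : Interp L F) {b : unitInterval} (hb : 0 < b) (t : Term V S F)
    (d : I.Dom) : b ≤ denote I t d ↔ ∃ α, Satisfies I α b t d := by
  constructor
  · intro h
    obtain ⟨α, hα⟩ := lt_iSup_iff.1 (hb.trans_le h)
    have hs := (le_denoteAt_iff I α hα t d).1 le_rfl
    -- Any `α'` with positive value agrees with `α` on the tags, so `α` already attains the
    -- supremum.
    refine ⟨α, (le_denoteAt_iff I α hb t d).1 (h.trans (iSup_le fun α' => ?_))⟩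
    rcases eq_or_ne (denoteAt I α' t d) 0 with h0 | h0
    · rw [h0]; exact hα.le
    · have hα' := unitInterval.pos_iff_ne_zero.2 h0
      have hs' := (le_denoteAt_iff I α' hα' t d).1 le_rfl
      refine (le_denoteAt_iff I α hα' t d).2 ⟨hs.root, hs.edge, fun X s h => ?_⟩
      rw [hs.eqOn hs' (t.mem_tags_of_hasSort h)]
      exact hs'.sort X s h
  · rintro ⟨α, hα⟩
    exact ((le_denoteAt_iff I α hb t d).2 hα).trans (le_iSup (fun α => denoteAt I α t d) α)

/-- Assignments are carried along morphisms. -/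
theorem Satisfies.map {I J : Interp L F} {α : V → I.Dom} {b c : unitInterval} {t : Term V S F}
    {d : I.Dom} (h : Satisfies I α c t d) {γ : I.Dom → J.Dom} (hγ : IsMorphism b I J γ) :
    Satisfies J (γ ∘ α) (min c b) t (γ d) :=
  ⟨congrArg γ h.root, fun X f Y e => by
    rw [Function.comp_apply, ← hγ.1, h.edge X f Y e, Function.comp_apply], fun X s e =>
    (min_le_min_right b (h.sort X s e)).trans (hγ.2 s _)⟩

theorem IsMorphism.comp {I J K : Interp L F} {b c : unitInterval} {γ : I.Dom → J.Dom}
    {δ : J.Dom → K.Dom} (hγ : IsMorphism b I J γ) (hδ : IsMorphism c J K δ) :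
    IsMorphism (min b c) I K (δ ∘ γ) :=
  ⟨fun f d => by rw [Function.comp_apply, hγ.1, hδ.1, Function.comp_apply], fun s d => by
    rw [← min_assoc]
    exact (min_le_min_right c (hγ.2 s d)).trans (hδ.2 s _)⟩

theorem isMorphism_id (I : Interp L F) : IsMorphism 1 I I id :=
  ⟨fun _ _ => rfl, fun _ _ => min_le_left _ _⟩

/-! ### Sorts in normal terms -/

namespace Term

theorem exists_hasSort (t : Term V S F) {X : V} (hX : X ∈ t.tags) : ∃ s, t.HasSort X s := by
  induction t with
  | mk W s n g t ih =>
    rcases hX with rfl | hX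
    · exact ⟨s, Or.inl ⟨rfl, rfl⟩⟩
    · obtain ⟨i, hi⟩ := Set.mem_iUnion.1 hX
      obtain ⟨s', h⟩ := ih i hi
      exact ⟨s', Or.inr ⟨i, h⟩⟩

theorem properOccurrences_pos_of_hasSort {top : S} (t : Term V S F) {X : V} {s : S}
    (h : t.HasSort X s) (hs : s ≠ top) : 1 ≤ t.properOccurrences top X := by
  induction t with
  | mk W s' n g t ih =>
    rw [properOccurrences]
    rcases h with ⟨rfl, rfl⟩ | ⟨i, hi⟩
    · simp [hs]
    · have h1 := Finset.single_le_sum (f := fun i => (t i).properOccurrences top X)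
        (fun i _ => Nat.zero_le _) (Finset.mem_univ i)
      have h2 := ih i hi
      omega

/-- Two different sorts other than `top` at one tag would be two proper occurrences of that tag.
Hence a tag of a normal term carries `⊤` and at most one further sort, which is then the most
specific. -/
theorem hasSort_unique {top : S} (t : Term V S F) {X : V} {s s' : S}
    (hX : t.properOccurrences top X ≤ 1) (h : t.HasSort X s) (h' : t.HasSort X s')
    (hs : s ≠ top) (hs' : s' ≠ top) : s = s' := by
  induction t with
  | mk W r n g t ih =>
    rw [properOccurrences] at hX
    have key : ∀ i, (t i).properOccurrences top X ≤ ∑ j, (t j).properOccurrences top X := fun i =>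
      Finset.single_le_sum (f := fun i => (t i).properOccurrences top X)
        (fun i _ => Nat.zero_le _) (Finset.mem_univ i)
    have key0 : ∀ j r', W = X → r ≠ top → r' ≠ top → (t j).HasSort X r' → False := by
      rintro j r' rfl hr hr' hj
      rw [if_pos ⟨rfl, fun h => hr h.1⟩] at hX
      have h1 := key j
      have h2 := (t j).properOccurrences_pos_of_hasSort hj hr'
      omega
    rcases h with ⟨e, rfl⟩ | ⟨i, hi⟩
    · rcases h' with ⟨-, rfl⟩ | ⟨j, hj⟩
      · rfl
      · exact (key0 j _ e hs hs' hj).elim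
    · rcases h' with ⟨e, rfl⟩ | ⟨j, hj⟩
      · exact (key0 i _ e hs' hs hi).elim
      · by_cases hij : i = j
        · subst hij
          exact ih i (by have := key i; omega) hi hj
        · have h1 := Finset.sum_le_sum_of_subset (f := fun i => (t i).properOccurrences top X)
            (Finset.subset_univ {i, j})
          rw [Finset.sum_pair hij] at h1
          have h2 := (t i).properOccurrences_pos_of_hasSort hi hs
          have h3 := (t j).properOccurrences_pos_of_hasSort hj hs'
          omega

theorem Normal.properOccurrences_le {t : Term V S F} (ht : t.Normal L) {X : V}
    (hX : X ∈ t.tags) : t.properOccurrences L.top X ≤ 1 := by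
  cases t with
  | mk W s n g t => exact ht.2.2.2 X hX

theorem isMostSpecificSort_sortOf {t : Term V S F} (ht : t.Normal L) {X : V} (hX : X ∈ t.tags) :
    t.IsMostSpecificSort L X (t.sortOf L X) := by
  have h : ∃ s, t.IsMostSpecificSort L X s := by
    by_cases h : ∃ s, t.HasSort X s ∧ s ≠ L.top
    · obtain ⟨s, hs, hne⟩ := h
      refine ⟨s, hs, fun s' hs' => ?_⟩
      by_cases hne' : s' = L.top
      · rw [hne', L.sub_top]; exact zero_lt_one
      · rw [t.hasSort_unique (ht.properOccurrences_le hX) hs hs' hne hne', L.partialOrder.refl]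
        exact zero_lt_one
    · push Not at h
      obtain ⟨s, hs⟩ := t.exists_hasSort hX
      refine ⟨s, hs, fun s' hs' => ?_⟩
      rw [h s' hs', L.sub_top]
      exact zero_lt_one
  rw [sortOf, dif_pos h]
  exact Classical.choose_spec h

theorem eq_sortOf_or_eq_top {t : Term V S F} (ht : t.Normal L) {X : V} {s : S}
    (h : t.HasSort X s) : s = t.sortOf L X ∨ s = L.top := by
  have hX := t.mem_tags_of_hasSort h
  have hm := isMostSpecificSort_sortOf ht hX
  by_cases hs : s = L.top
  · exact Or.inr hs
  · refine Or.inl (t.hasSort_unique (ht.properOccurrences_le hX) h hm.1 hs fun e => hs ?_)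
    have := hm.2 s h
    rw [e] at this
    exact L.partialOrder.antisymm _ _ (by rw [L.sub_top]; exact zero_lt_one) this

end Term

/-- For a normal term it suffices to check the most specific sorts. -/
theorem Satisfies.of_sortOf {I : Interp L F} {α : V → I.Dom} {b : unitInterval} {t : Term V S F}
    (ht : t.Normal L) {d : I.Dom} (root : d = α t.rootTag)
    (edge : ∀ X f Y, t.Edge X f Y → I.feat f (α X) = α Y)
    (sort : ∀ X ∈ t.tags, b ≤ I.sort (t.sortOf L X) (α X)) : Satisfies I α b t d := by
  refine ⟨root, edge, fun X s h => ?_⟩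
  rcases Term.eq_sortOf_or_eq_top ht h with rfl | rfl
  · exact sort X (t.mem_tags_of_hasSort h)
  · rw [I.sort_top]; exact unitInterval.le_one'

/-! ### Subgraphs and the graph algebra -/

namespace OSFGraph

variable {W : Type u}

theorem subgraphAt_root (g : OSFGraph L F W) (h : g.root ∈ g.nodes) :
    g.subgraphAt g.root h = g := by
  have hn : g.reach g.root = g.nodes :=
    Set.Subset.antisymm (g.reach_subset h) fun x hx => g.reachable x hx
  ext1
  · exact hn
  · rfl
  · funext x
    change (if x ∈ g.reach g.root then g.label x else L.top) = _
    split_ifs with hx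
    · rfl
    · exact (g.label_off x (hn ▸ hx)).symm
  · ext ⟨x, f, y⟩
    refine ⟨fun h => h.1, fun h => ⟨h, ?_⟩⟩
    rw [hn]
    exact g.src_mem x f y h

theorem reach_subgraphAt (g : OSFGraph L F W) {y z : W} (hy : y ∈ g.nodes) (hz : z ∈ g.reach y) :
    (g.subgraphAt y hy).reach z = g.reach z := by
  ext x
  constructor
  · exact Relation.ReflTransGen.mono (fun a b ⟨f, h⟩ => ⟨f, h.1⟩) z x
  · intro hx
    induction hx with
    | refl => exact Relation.ReflTransGen.refl
    | tail h₁ h₂ ih =>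
      obtain ⟨f, hf⟩ := h₂
      exact ih.tail ⟨f, hf, hz.trans h₁⟩

theorem subgraphAt_subgraphAt (g : OSFGraph L F W) {y z : W} (hy : y ∈ g.nodes)
    (hz : z ∈ (g.subgraphAt y hy).nodes) :
    (g.subgraphAt y hy).subgraphAt z hz = g.subgraphAt z (g.reach_subset hy hz) := by
  have hn := g.reach_subgraphAt hy hz
  have hs : ∀ x ∈ g.reach z, x ∈ g.reach y := fun x hx => Relation.ReflTransGen.trans hz hx
  ext1
  · exact hn
  · rfl
  · funext x
    change (if x ∈ (g.subgraphAt y hy).reach z then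
      (if x ∈ g.reach y then g.label x else L.top) else L.top) = if x ∈ g.reach z then _ else _
    rw [hn]
    by_cases hx : x ∈ g.reach z
    · simp [hx, hs x hx]
    · simp [hx]
  · ext ⟨x, f, w⟩
    change ((x, f, w) ∈ g.edges ∧ x ∈ g.reach y) ∧ x ∈ (g.subgraphAt y hy).reach z ↔
      (x, f, w) ∈ g.edges ∧ x ∈ g.reach z
    rw [hn]
    exact ⟨fun h => ⟨h.1.1, h.2⟩, fun h => ⟨⟨h.1, hs x h.2⟩, h.2⟩⟩

end OSFGraph

theorem graphFeat_of_edge {f : F} {g : OSFGraph L F (Node V S F)} {y : Node V S F}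
    (h : (g.root, f, y) ∈ g.edges) :
    graphFeat f g = g.subgraphAt y (g.tgt_mem _ _ _ h) := by
  have h' : ∃ y, (g.root, f, y) ∈ g.edges := ⟨y, h⟩
  have e : Classical.choose h' = y := g.functional _ _ _ _ (Classical.choose_spec h') h
  rw [graphFeat, dif_pos h']
  congr

theorem graphFeat_of_not_edge {f : F} {g : OSFGraph L F (Node V S F)}
    (h : ¬ ∃ y, (g.root, f, y) ∈ g.edges) :
    graphFeat f g = OSFGraph.trivial L F g.top_ne_bot (newNode f g) := by
  rw [graphFeat, dif_neg h]

theorem graphFeat_subgraphAt {f : F} {g : OSFGraph L F (Node V S F)} {x y : Node V S F}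
    (h : (x, f, y) ∈ g.edges) :
    graphFeat f (g.subgraphAt x (g.src_mem _ _ _ h)) = g.subgraphAt y (g.tgt_mem _ _ _ h) := by
  have h' : ((g.subgraphAt x (g.src_mem _ _ _ h)).root, f, y) ∈
      (g.subgraphAt x (g.src_mem _ _ _ h)).edges := ⟨h, Relation.ReflTransGen.refl⟩
  rw [graphFeat_of_edge h', OSFGraph.subgraphAt_subgraphAt]

theorem label_root_subgraphAt (g : OSFGraph L F (Node V S F)) {y : Node V S F} (h : y ∈ g.nodes) :
    (g.subgraphAt y h).label (g.subgraphAt y h).root = g.label y :=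
  if_pos Relation.ReflTransGen.refl

theorem Interp.word_append (I : Interp L F) (w : List F) (f : F) (d : I.Dom) :
    I.word (w ++ [f]) d = I.feat f (I.word w d) := by
  simp [Interp.word]

namespace Term

theorem tag_mem_nodes {t : Term V S F} (ht : t.Normal L) {X : V} (hX : X ∈ t.tags) :
    Node.tag X ∈ (t.graph L ht).nodes := ⟨X, hX, rfl⟩

theorem edge_mem_edges {t : Term V S F} (ht : t.Normal L) {X Y : V} {f : F} :
    (Node.tag X, f, Node.tag Y) ∈ (t.graph L ht).edges ↔ t.Edge X f Y := by
  constructor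
  · rintro ⟨⟨X', f', Y'⟩, h, e⟩
    cases e
    exact h
  · exact fun h => ⟨(X, f, Y), h, rfl⟩

/-- The subgraph of `G(t)` at a tag. -/
noncomputable def graphAt {t : Term V S F} (ht : t.Normal L) (X : V) : OSFGraph L F (Node V S F) :=
  if h : X ∈ t.tags then (t.graph L ht).subgraphAt (.tag X) (tag_mem_nodes ht h)
  -- The value off the tags is irrelevant, but it is kept inside the generated subalgebra so that
  -- `graphAt_mem_closure` needs no hypothesis on `X`.
  else t.graph L ht

theorem graphAt_of_mem {t : Term V S F} (ht : t.Normal L) {X : V} (h : X ∈ t.tags) :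
    graphAt ht X = (t.graph L ht).subgraphAt (.tag X) (tag_mem_nodes ht h) := dif_pos h

theorem graphAt_rootTag {t : Term V S F} (ht : t.Normal L) :
    graphAt ht t.rootTag = t.graph L ht := by
  rw [graphAt_of_mem ht t.rootTag_mem_tags]
  exact OSFGraph.subgraphAt_root _ _

theorem root_graphAt {t : Term V S F} (ht : t.Normal L) {X : V} (h : X ∈ t.tags) :
    (graphAt ht X).root = .tag X := by
  rw [graphAt_of_mem ht h]; rfl

theorem label_root_graphAt {t : Term V S F} (ht : t.Normal L) {X : V} (h : X ∈ t.tags) :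
    (graphAt ht X).label (graphAt ht X).root = t.sortOf L X := by
  rw [graphAt_of_mem ht h, label_root_subgraphAt]; rfl

theorem graphFeat_graphAt {t : Term V S F} (ht : t.Normal L) {X Y : V} {f : F}
    (h : t.Edge X f Y) : graphFeat f (graphAt ht X) = graphAt ht Y := by
  rw [graphAt_of_mem ht (t.edge_mem_tags h).1, graphAt_of_mem ht (t.edge_mem_tags h).2]
  exact graphFeat_subgraphAt ((edge_mem_edges ht).2 h)

theorem graphFeat_graphAt_of_not_edge {t : Term V S F} (ht : t.Normal L) {X : V} {f : F}
    (hX : X ∈ t.tags) (h : ¬ ∃ Y, t.Edge X f Y) :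
    graphFeat f (graphAt ht X) =
      OSFGraph.trivial L F (graphAt ht X).top_ne_bot (newNode f (graphAt ht X)) := by
  apply graphFeat_of_not_edge
  rintro ⟨y, hy⟩
  rw [graphAt_of_mem ht hX] at hy
  obtain ⟨⟨X', f', Y⟩, he, e⟩ := hy.1
  cases e
  exact h ⟨Y, he⟩

theorem graphAt_mem_closure {t : Term V S F} (ht : t.Normal L) (X : V) :
    graphAt ht X ∈ (graphAlgebra V L F).closure {t.graph L ht} := by
  by_cases hX : X ∈ t.tags
  · have := t.reachable_tags hX
    clear hX
    induction this with
    | refl =>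
      rw [graphAt_rootTag]
      exact (graphAlgebra V L F).mem_closure_singleton _
    | tail _ hf ih =>
      obtain ⟨f, hf⟩ := hf
      rw [← graphFeat_graphAt ht hf]
      exact (graphAlgebra V L F).feat_mem_closure _ f ih
  · rw [graphAt, dif_neg hX]
    exact (graphAlgebra V L F).mem_closure_singleton _

end Term

/-! ### Freeness of the subalgebra generated by the graph of a term -/

theorem satisfies_graphAt {t : Term V S F} (ht : t.Normal L) :
    Satisfies (graphAlgebra V L F) (Term.graphAt ht) 1 t (t.graph L ht) := by
  refine Satisfies.of_sortOf ht (Term.graphAt_rootTag ht).symm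
    (fun X f Y h => Term.graphFeat_graphAt ht h) fun X hX => ?_
  change 1 ≤ L.sub ((Term.graphAt ht X).label _) _
  rw [Term.label_root_graphAt ht hX, L.partialOrder.refl]

theorem satisfies_graphAt_generated {t : Term V S F} (ht : t.Normal L) :
    Satisfies ((graphAlgebra V L F).generated {t.graph L ht})
      (fun X => ⟨Term.graphAt ht X, Term.graphAt_mem_closure ht X⟩) 1 t
      ((graphAlgebra V L F).gen (t.graph L ht)) :=
  ⟨Subtype.ext (satisfies_graphAt ht).root,
    fun X f Y h => Subtype.ext ((satisfies_graphAt ht).edge X f Y h), (satisfies_graphAt ht).sort⟩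

/-- The elements of the subalgebra generated by `G(t)`: subgraphs at tags, and trivial graphs. -/
theorem word_graph {t : Term V S F} (ht : t.Normal L) {I : Interp L F} {α : V → I.Dom}
    {b : unitInterval} {d : I.Dom} (h : Satisfies I α b t d) (w : List F) :
    (∃ X ∈ t.tags, (graphAlgebra V L F).word w (t.graph L ht) = Term.graphAt ht X ∧
      I.word w d = α X) ∨
    ∃ u f, w = u ++ [f] ∧ ∃ hL, (graphAlgebra V L F).word w (t.graph L ht) =
      OSFGraph.trivial L F hL (newNode f ((graphAlgebra V L F).word u (t.graph L ht))) := by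
  induction w using List.reverseRecOn with
  | nil => exact Or.inl ⟨_, t.rootTag_mem_tags, (Term.graphAt_rootTag ht).symm, h.root⟩
  | append_singleton w f ih =>
    have hw : (graphAlgebra V L F).word (w ++ [f]) (t.graph L ht) =
      graphFeat f ((graphAlgebra V L F).word w (t.graph L ht)) := Interp.word_append _ _ _ _
    rcases ih with ⟨X, hX, h1, h2⟩ | ⟨u, f', -, hL, h1⟩
    · by_cases hf : ∃ Y, t.Edge X f Y
      · obtain ⟨Y, hY⟩ := hf
        refine Or.inl ⟨Y, (t.edge_mem_tags hY).2, ?_, ?_⟩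
        · rw [hw, h1, Term.graphFeat_graphAt ht hY]
        · rw [Interp.word_append, h2, h.edge X f Y hY]
      · refine Or.inr ⟨w, f, rfl, t.top_ne_bot_of_normal ht, ?_⟩
        rw [hw, h1, Term.graphFeat_graphAt_of_not_edge ht hX hf]
    -- A trivial graph has no edges, so each further feature again gives a trivial graph, on a new
    -- variable recording its predecessor.
    · refine Or.inr ⟨w, f, rfl, t.top_ne_bot_of_normal ht, ?_⟩
      rw [hw]
      apply graphFeat_of_not_edge
      rw [h1]
      rintro ⟨y, hy⟩
      exact hy

/-- This makes the map `w(G(t)) ↦ w(d)` well defined. Equal graphs have equal roots. If the root is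
a tag, both words lead to the value of `α` at that tag; if it is a new variable, that variable
determines the last feature and the preceding graph, so both words lose the same last letter and
induction applies. -/
theorem word_eq_of_word_graph_eq {t : Term V S F} (ht : t.Normal L) {I : Interp L F}
    {α : V → I.Dom} {b : unitInterval} {d : I.Dom} (h : Satisfies I α b t d) (w w' : List F)
    (hw : (graphAlgebra V L F).word w (t.graph L ht) =
      (graphAlgebra V L F).word w' (t.graph L ht)) : I.word w d = I.word w' d := by
  induction w using List.reverseRecOn generalizing w' with
  | nil =>
    rcases word_graph ht h [] with ⟨X, hX, h1, h2⟩ | ⟨u, f, e, -⟩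
    · rcases word_graph ht h w' with ⟨Y, hY, h1', h2'⟩ | ⟨u, f, -, hL, h1'⟩
      · have := congrArg OSFGraph.root (h1.symm.trans (hw.trans h1'))
        rw [Term.root_graphAt ht hX, Term.root_graphAt ht hY] at this
        cases this
        rw [h2, h2']
      · have := congrArg OSFGraph.root (h1.symm.trans (hw.trans h1'))
        rw [Term.root_graphAt ht hX] at this
        cases this
    · simp at e
  | append_singleton u f ih =>
    rcases word_graph ht h (u ++ [f]) with ⟨X, hX, h1, h2⟩ | ⟨u₁, f₁, e, hL, h1⟩
    · rcases word_graph ht h w' with ⟨Y, hY, h1', h2'⟩ | ⟨u, f, -, hL, h1'⟩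
      · have := congrArg OSFGraph.root (h1.symm.trans (hw.trans h1'))
        rw [Term.root_graphAt ht hX, Term.root_graphAt ht hY] at this
        cases this
        rw [h2, h2']
      · have := congrArg OSFGraph.root (h1.symm.trans (hw.trans h1'))
        rw [Term.root_graphAt ht hX] at this
        cases this
    · obtain ⟨rfl, e2⟩ := List.append_inj' e rfl
      cases e2
      rcases word_graph ht h w' with ⟨Y, hY, h1', h2'⟩ | ⟨u', f', rfl, hL', h1'⟩
      · have := congrArg OSFGraph.root (h1.symm.trans (hw.trans h1'))
        rw [Term.root_graphAt ht hY] at this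
        cases this
      · have := congrArg OSFGraph.root (h1.symm.trans (hw.trans h1'))
        obtain ⟨rfl, hg⟩ := newNode_injective this
        rw [Interp.word_append, Interp.word_append, ih u' hg]

/-- The degree of `d` in the denotation of `t` is at least `b` exactly when there is a
`b`-morphism from the subalgebra generated by the graph of `t` that maps this graph to `d`. -/
theorem le_denote_iff_morphism {t : Term V S F} (ht : t.Normal L) (I : Interp L F)
    {b : unitInterval} (hb : 0 < b) (d : I.Dom) :
    b ≤ denote I t d ↔
      ∃ γ, IsMorphism b ((graphAlgebra V L F).generated {t.graph L ht}) I γ ∧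
        γ ((graphAlgebra V L F).gen (t.graph L ht)) = d := by
  rw [le_denote_iff I hb]
  constructor
  -- The morphism sends an element of the subalgebra to the value at `d` of any word producing it;
  -- `key` is independence of the word.
  · rintro ⟨α, h⟩
    have hex : ∀ x : ((graphAlgebra V L F).generated {t.graph L ht}).Dom, ∃ w,
        (graphAlgebra V L F).word w (t.graph L ht) = x.1 := by
      rintro ⟨x, hx⟩
      obtain ⟨w, _, rfl, hw⟩ := Set.mem_iUnion.1 hx
      exact ⟨w, hw⟩
    choose w hw using hex
    have key : ∀ x u, (graphAlgebra V L F).word u (t.graph L ht) = x.1 →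
        I.word (w x) d = I.word u d := fun x u hu =>
      word_eq_of_word_graph_eq ht h _ _ ((hw x).trans hu.symm)
    refine ⟨fun x => I.word (w x) d, ⟨fun f x => ?_, fun s x => ?_⟩, key _ [] rfl⟩
    · dsimp only
      rw [← Interp.word_append]
      apply key
      exact (Interp.word_append _ _ _ _).trans (congrArg (graphFeat f) (hw x))
    · change min (L.sub (x.1.label x.1.root) s) b ≤ I.sort s (I.word (w x) d)
      rcases word_graph ht h (w x) with ⟨X, hX, h1, h2⟩ | ⟨u, f, -, hL, h1⟩
      · rw [h2, ← hw x, h1, Term.label_root_graphAt ht hX, min_comm]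
        exact (min_le_min_right _ (h.sort X _ (Term.isMostSpecificSort_sortOf ht hX).1)).trans
          (I.sort_sub _ _ _)
      -- A trivial graph is labelled `⊤`, whose degree is `1` everywhere, so the sort condition
      -- follows from `sort_sub` alone.
      · rw [← hw x, h1]
        have := I.sort_sub L.top s (I.word (w x) d)
        rw [I.sort_top, min_eq_right unitInterval.le_one'] at this
        exact (min_le_left _ _).trans this
  -- The canonical assignment of subgraphs to tags has degree `1`; pushing it along `γ` costs only
  -- `b`.
  · rintro ⟨γ, hγ, rfl⟩
    refine ⟨_, ((satisfies_graphAt_generated ht).map hγ).mono ?_⟩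
    exact le_min unitInterval.le_one' le_rfl

/-! ### Equivalent terms and their denotations -/

theorem TermEquiv.symm {ψ₀ ψ₁ : {t : Term V S F // t.Normal L}} (h : TermEquiv L ψ₀ ψ₁) :
    TermEquiv L ψ₁ ψ₀ := ⟨h.2, h.1⟩

theorem TermEquiv.refl (ψ : {t : Term V S F // t.Normal L}) : TermEquiv L ψ ψ :=
  ⟨⟨id, isMorphism_id _, rfl⟩, ⟨id, isMorphism_id _, rfl⟩⟩

theorem TermEquiv.trans {ψ₀ ψ₁ ψ₂ : {t : Term V S F // t.Normal L}} (h : TermEquiv L ψ₀ ψ₁)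
    (h' : TermEquiv L ψ₁ ψ₂) : TermEquiv L ψ₀ ψ₂ := by
  obtain ⟨⟨γ, hγ, e⟩, γ', hγ', e'⟩ := h
  obtain ⟨⟨δ, hδ, i⟩, δ', hδ', i'⟩ := h'
  refine ⟨⟨δ ∘ γ, ?_, by rw [Function.comp_apply, e, i]⟩,
    γ' ∘ δ', ?_, by rw [Function.comp_apply, i', e']⟩
  · simpa using hγ.comp hδ
  · simpa using hδ'.comp hγ'

/-- Precomposing with a `1`-morphism between the generated subalgebras does not lower the degree;
the inequality runs against the direction of that morphism. -/
theorem TermEquiv.denote_le {ψ₀ ψ₁ : {t : Term V S F // t.Normal L}} (h : TermEquiv L ψ₀ ψ₁)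
    (I : Interp L F) (d : I.Dom) : denote I ψ₁.1 d ≤ denote I ψ₀.1 d := by
  rcases eq_or_ne (denote I ψ₁.1 d) 0 with h0 | h0
  · rw [h0]; exact unitInterval.nonneg'
  · have hpos := unitInterval.pos_iff_ne_zero.2 h0
    obtain ⟨γ, hγ, hd⟩ := (le_denote_iff_morphism ψ₁.2 I hpos d).1 le_rfl
    obtain ⟨⟨δ, hδ, e⟩, -⟩ := h
    refine (le_denote_iff_morphism ψ₀.2 I hpos d).2 ⟨γ ∘ δ, ?_, ?_⟩
    · have := hδ.comp hγ
      rwa [min_eq_right unitInterval.le_one'] at this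
    · rw [Function.comp_apply, e, hd]

theorem TermEquiv.denote_eq {ψ₀ ψ₁ : {t : Term V S F // t.Normal L}} (h : TermEquiv L ψ₀ ψ₁)
    (I : Interp L F) (d : I.Dom) : denote I ψ₀.1 d = denote I ψ₁.1 d :=
  le_antisymm (h.symm.denote_le I d) (h.denote_le I d)

theorem TermEquiv.semSub_eq {ψ₀ ψ₁ ψ₀' ψ₁' : {t : Term V S F // t.Normal L}}
    (h₀ : TermEquiv L ψ₀ ψ₀') (h₁ : TermEquiv L ψ₁ ψ₁') :
    semSub L ψ₀.1 ψ₁.1 = semSub L ψ₀'.1 ψ₁'.1 := by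
  simp only [semSub, h₀.denote_eq, h₁.denote_eq]

/-- Reduces equivalence to exhibiting two assignments of degree `1`, so that no morphism has to be
built by hand. -/
theorem termEquiv_of_satisfies {ψ₀ ψ₁ : {t : Term V S F // t.Normal L}}
    (h : ∃ α, Satisfies ((graphAlgebra V L F).generated {ψ₁.1.graph L ψ₁.2}) α 1 ψ₀.1
      ((graphAlgebra V L F).gen (ψ₁.1.graph L ψ₁.2)))
    (h' : ∃ α, Satisfies ((graphAlgebra V L F).generated {ψ₀.1.graph L ψ₀.2}) α 1 ψ₁.1
      ((graphAlgebra V L F).gen (ψ₀.1.graph L ψ₀.2))) : TermEquiv L ψ₀ ψ₁ :=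
  ⟨(le_denote_iff_morphism ψ₀.2 _ zero_lt_one _).1 ((le_denote_iff _ zero_lt_one _ _).2 h),
    (le_denote_iff_morphism ψ₁.2 _ zero_lt_one _).1 ((le_denote_iff _ zero_lt_one _ _).2 h')⟩

/-! ### Adding a leaf to a normal term -/

namespace Term

theorem properOccurrences_eq_zero (top : S) {X : V} (t : Term V S F) (hX : X ∉ t.tags) :
    t.properOccurrences top X = 0 := by
  induction t with
  | mk W s n g t ih =>
    rw [properOccurrences, if_neg fun h => hX (Or.inl h.1.symm), zero_add]
    exact Finset.sum_eq_zero fun i _ => ih i fun h => hX (Or.inr (Set.mem_iUnion.2 ⟨i, h⟩))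

/-- `IsLeafExtension L t X f Y t'`: the term `t'` arises from `t` by adding the leaf `Y : ⊤` at a
new feature `f` of `X`. -/
structure IsLeafExtension (L : SortLattice S) (t : Term V S F) (X : V) (f : F) (Y : V)
    (t' : Term V S F) : Prop where
  rootTag : t'.rootTag = t.rootTag
  edge : ∀ A a B, t'.Edge A a B ↔ t.Edge A a B ∨ (A = X ∧ a = f ∧ B = Y)
  hasSort : ∀ A s, t'.HasSort A s ↔ t.HasSort A s ∨ (A = Y ∧ s = L.top)
  tags : t'.tags = insert Y t.tags
  properOccurrences : ∀ A, A ≠ X →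
    t'.properOccurrences L.top A = t.properOccurrences L.top A
  -- The exact counts let normality pass to the enclosing terms during the induction. The new leaf
  -- `Y : ⊤` itself is not a proper occurrence.
  properOccurrences_self : t'.properOccurrences L.top X = 1
  normal : t'.Normal L

theorem exists_snoc {β : Type*} {n : ℕ} (t : Fin n → Term V S F) (u : Term V S F) (g : Fin n → β)
    (f : β) (P : β → Term V S F → Prop) :
    (∃ i, P (Fin.snoc (α := fun _ => β) g f i) (Fin.snoc (α := fun _ => Term V S F) t u i)) ↔
      (∃ i, P (g i) (t i)) ∨ P f u := by
  constructor
  · rintro ⟨i, hi⟩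
    induction i using Fin.lastCases with
    | last => exact Or.inr (by simpa using hi)
    | cast i => exact Or.inl ⟨i, by simpa using hi⟩
  · rintro (⟨i, hi⟩ | h)
    · exact ⟨i.castSucc, by simpa using hi⟩
    · exact ⟨Fin.last n, by simpa using h⟩

theorem isLeafExtension_append {W : V} {s : S} {n : ℕ} {g : Fin n → F} {t : Fin n → Term V S F}
    (ht : (mk W s n g t).Normal L) {f : F} {Y : V} (hY : Y ∉ (mk W s n g t).tags)
    (hf : ¬ ∃ Z, (mk W s n g t).Edge W f Z) :
    IsLeafExtension L (mk W s n g t) W f Y (mk W s (n + 1) (Fin.snoc g f)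
      (Fin.snoc (α := fun _ => Term V S F) t (mk Y L.top 0 Fin.elim0 Fin.elim0))) := by
  have hleaf : ∀ A, (mk Y L.top 0 Fin.elim0 Fin.elim0 : Term V S F).properOccurrences L.top A = 0 :=
    fun A => by simp [Term.properOccurrences]
  have hW := ht.2.2.2 W (Or.inl rfl)
  -- Either there are no subterms, or the root already uses up the single proper occurrence allowed
  -- to `W`.
  have hsum : ∑ i, (t i).properOccurrences L.top W = 0 := by
    rw [Term.properOccurrences] at hW
    by_cases h : s = L.top ∧ n = 0
    · obtain ⟨-, rfl⟩ := h
      simp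
    · rw [if_pos ⟨rfl, h⟩] at hW
      omega
  have htags : (mk W s (n + 1) (Fin.snoc g f) (Fin.snoc (α := fun _ => Term V S F) t
      (mk Y L.top 0 Fin.elim0 Fin.elim0))).tags = insert Y (mk W s n g t).tags := by
    ext A
    have := exists_snoc t (mk Y L.top 0 Fin.elim0 Fin.elim0) g f fun _ r => A ∈ r.tags
    simp only [Term.tags, Set.mem_union, Set.mem_iUnion, Set.mem_singleton_iff, this,
      Set.mem_insert_iff, IsEmpty.exists_iff, or_false]
    rw [← or_assoc, or_comm]
  have hp : ∀ A, A ≠ W → (mk W s (n + 1) (Fin.snoc g f) (Fin.snoc (α := fun _ => Term V S F) t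
      (mk Y L.top 0 Fin.elim0 Fin.elim0))).properOccurrences L.top A =
      (mk W s n g t).properOccurrences L.top A := by
    intro A hA
    simp [Term.properOccurrences, Fin.sum_univ_castSucc, hA.symm]
  have hp' : (mk W s (n + 1) (Fin.snoc g f) (Fin.snoc (α := fun _ => Term V S F) t
      (mk Y L.top 0 Fin.elim0 Fin.elim0))).properOccurrences L.top W = 1 := by
    simp only [Term.properOccurrences, Fin.sum_univ_castSucc, Fin.snoc_castSucc, Fin.snoc_last,
      hsum]
    simp
  refine ⟨rfl, ?_, ?_, htags, hp, hp', ht.1, ?_, ?_, ?_⟩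
  · intro A a B
    have h1 := exists_snoc t (mk Y L.top 0 Fin.elim0 Fin.elim0) g f fun b r =>
      b = a ∧ r.rootTag = B
    have h2 := exists_snoc t (mk Y L.top 0 Fin.elim0 Fin.elim0) g f fun _ r => r.Edge A a B
    simp only [Term.Edge, h1, h2, IsEmpty.exists_iff, and_false, or_false, and_or_left]
    rw [or_right_comm, eq_comm (a := A), eq_comm (a := a), eq_comm (a := B)]
    rfl
  · intro A r
    have := exists_snoc t (mk Y L.top 0 Fin.elim0 Fin.elim0) g f fun _ u => u.HasSort A r
    simp only [Term.HasSort, this, IsEmpty.exists_iff, or_false]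
    rw [or_assoc, eq_comm (a := A) (b := Y), eq_comm (a := r) (b := L.top)]
  · refine Fin.lastCases ?_ fun i => ?_
    · refine Fin.lastCases (fun _ => rfl) fun j h => ?_
      simp only [Fin.snoc_last, Fin.snoc_castSucc] at h
      exact (hf ⟨_, Or.inl ⟨rfl, j, h.symm, rfl⟩⟩).elim
    · refine Fin.lastCases (fun h => ?_) fun j h => ?_
      · simp only [Fin.snoc_last, Fin.snoc_castSucc] at h
        exact (hf ⟨_, Or.inl ⟨rfl, i, h, rfl⟩⟩).elim
      · simp only [Fin.snoc_castSucc] at h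
        rw [ht.2.1 h]
  · refine Fin.lastCases ?_ fun i => ?_
    · simp only [Fin.snoc_last]
      exact ⟨L.top_ne_bot ht.1, fun i => i.elim0, fun i => i.elim0, fun A _ => (hleaf A).le.trans
        zero_le_one⟩
    · simp only [Fin.snoc_castSucc]
      exact ht.2.2.1 i
  · intro A hA
    by_cases h : A = W
    · rw [h, hp']
    · rw [hp A h]
      rw [htags] at hA
      rcases hA with rfl | hA
      · rw [properOccurrences_eq_zero _ _ hY]; exact zero_le_one
      · exact ht.2.2.2 A hA

theorem isLeafExtension_update {W : V} {s : S} {n : ℕ} {g : Fin n → F} {t : Fin n → Term V S F}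
    (ht : (mk W s n g t).Normal L) {X : V} {f : F} {Y : V} (hWX : W ≠ X)
    (hY : Y ∉ (mk W s n g t).tags) (i : Fin n)
    (hi : ∀ j, j ≠ i → (t j).properOccurrences L.top X = 0) {t' : Term V S F}
    (h : IsLeafExtension L (t i) X f Y t') :
    IsLeafExtension L (mk W s n g t) X f Y (mk W s n g (Function.update t i t')) := by
  have hex : ∀ (P : Term V S F → Prop) (R : Prop), (P t' ↔ P (t i) ∨ R) →
      ((∃ j, P (Function.update t i t' j)) ↔ (∃ j, P (t j)) ∨ R) := by
    intro P R hP
    constructor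
    · rintro ⟨j, hj⟩
      by_cases e : j = i
      · subst e
        rw [Function.update_self, hP] at hj
        exact hj.imp_left fun h => ⟨j, h⟩
      · rw [Function.update_of_ne e] at hj
        exact Or.inl ⟨j, hj⟩
    · rintro (⟨j, hj⟩ | hR)
      · by_cases e : j = i
        · subst e
          exact ⟨j, by rw [Function.update_self, hP]; exact Or.inl hj⟩
        · exact ⟨j, by rwa [Function.update_of_ne e]⟩
      · exact ⟨i, by rw [Function.update_self, hP]; exact Or.inr hR⟩
  have hroot : ∀ j, (Function.update t i t' j).rootTag = (t j).rootTag := by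
    intro j
    by_cases e : j = i
    · subst e; rw [Function.update_self, h.rootTag]
    · rw [Function.update_of_ne e]
  have htags : (mk W s n g (Function.update t i t')).tags = insert Y (mk W s n g t).tags := by
    ext A
    have := hex (fun r => A ∈ r.tags) (A = Y) (by rw [h.tags, Set.mem_insert_iff, or_comm])
    simp only [Term.tags, Set.mem_union, Set.mem_iUnion, Set.mem_singleton_iff, this,
      Set.mem_insert_iff]
    rw [← or_assoc, or_comm]
  have hp : ∀ A, A ≠ X → (mk W s n g (Function.update t i t')).properOccurrences L.top A =
      (mk W s n g t).properOccurrences L.top A := by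
    intro A hA
    simp only [Term.properOccurrences]
    congr 1
    refine Finset.sum_congr rfl fun j _ => ?_
    by_cases e : j = i
    · subst e; rw [Function.update_self, h.properOccurrences A hA]
    · rw [Function.update_of_ne e]
  have hp' : (mk W s n g (Function.update t i t')).properOccurrences L.top X = 1 := by
    rw [Term.properOccurrences, if_neg fun h => hWX h.1, zero_add,
      Finset.sum_eq_single i (fun j _ e => by rw [Function.update_of_ne e, hi j e])
        (fun h => (h (Finset.mem_univ i)).elim), Function.update_self, h.properOccurrences_self]
  refine ⟨rfl, ?_, ?_, htags, hp, hp', ht.1, ht.2.1, ?_, ?_⟩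
  · intro A a B
    have := hex (fun r => r.Edge A a B) _ (h.edge A a B)
    simp only [Term.Edge, this, hroot, or_assoc]
  · intro A r
    have := hex (fun u => u.HasSort A r) _ (h.hasSort A r)
    simp only [Term.HasSort, this, or_assoc]
  · intro j
    by_cases e : j = i
    · subst e; rw [Function.update_self]; exact h.normal
    · rw [Function.update_of_ne e]; exact ht.2.2.1 j
  · intro A hA
    by_cases h : A = X
    · rw [h, hp']
    · rw [hp A h]
      rw [htags] at hA
      rcases hA with rfl | hA
      · rw [properOccurrences_eq_zero _ _ hY]; exact zero_le_one
      · exact ht.2.2.2 A hA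

theorem exists_isLeafExtension (t : Term V S F) (ht : t.Normal L) {X : V} {f : F} {Y : V}
    (hX : X ∈ t.tags) (hY : Y ∉ t.tags) (hf : ¬ ∃ Z, t.Edge X f Z) :
    ∃ t', IsLeafExtension L t X f Y t' := by
  induction t with
  | mk W s n g t ih =>
    by_cases hWX : W = X
    · subst hWX
      exact ⟨_, isLeafExtension_append ht hY hf⟩
    have hsum := ht.2.2.2 X hX
    rw [Term.properOccurrences, if_neg fun h => hWX h.1, zero_add] at hsum
    -- The leaf must go where `X` has its proper occurrence, if there is one, since extending a bare
    -- `X : ⊤` elsewhere would create a second one. Otherwise any subterm containing `X` will do.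
    have hi : ∃ i, X ∈ (t i).tags ∧ ∀ j, j ≠ i → (t j).properOccurrences L.top X = 0 := by
      by_cases h : ∃ i, (t i).properOccurrences L.top X ≠ 0
      · obtain ⟨i, hi⟩ := h
        refine ⟨i, by_contra fun h => hi (properOccurrences_eq_zero _ _ h), fun j e => ?_⟩
        have h1 := Finset.sum_le_sum_of_subset (f := fun i => (t i).properOccurrences L.top X)
          (Finset.subset_univ {i, j})
        rw [Finset.sum_pair e.symm] at h1
        omega
      · push Not at h
        rcases hX with rfl | hX
        · exact (hWX rfl).elim
        · obtain ⟨i, hi⟩ := Set.mem_iUnion.1 hX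
          exact ⟨i, hi, fun j _ => h j⟩
    obtain ⟨i, hXi, hi⟩ := hi
    obtain ⟨t', ht'⟩ := ih i (ht.2.2.1 i) hXi (fun h => hY (Or.inr (Set.mem_iUnion.2 ⟨i, h⟩)))
      (fun ⟨Z, h⟩ => hf ⟨Z, Or.inr ⟨i, h⟩⟩)
    exact ⟨_, isLeafExtension_update ht hWX hY i hi ht'⟩

end Term

/-- Adding a leaf does not change a term up to equivalence. -/
theorem termEquiv_of_isLeafExtension {t t' : Term V S F} (ht : t.Normal L) {X : V} {f : F} {Y : V}
    (hX : X ∈ t.tags) (hY : Y ∉ t.tags) (h : t.IsLeafExtension L X f Y t') :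
    TermEquiv L ⟨t, ht⟩ ⟨t', h.normal⟩ := by
  apply termEquiv_of_satisfies
  · have hs := satisfies_graphAt_generated h.normal
    refine ⟨_, ?_, fun A a B e => hs.edge A a B ((h.edge A a B).2 (Or.inl e)),
      fun A s e => hs.sort A s ((h.hasSort A s).2 (Or.inl e))⟩
    rw [← h.rootTag]
    exact hs.root
  · have hs := satisfies_graphAt_generated ht
    set I := (graphAlgebra V L F).generated {t.graph L ht}
    set α : V → I.Dom := fun X => ⟨Term.graphAt ht X, Term.graphAt_mem_closure ht X⟩
    have hα : ∀ A ∈ t.tags, Function.update α Y (I.feat f (α X)) A = α A := fun A hA =>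
      Function.update_of_ne (by rintro rfl; exact hY hA) _ _
    -- Features are total, so `f` already has a value at `α X`; the new tag receives it, and its
    -- sort `⊤` imposes nothing.
    refine ⟨Function.update α Y (I.feat f (α X)), ?_, fun A a B e => ?_, fun A s e => ?_⟩
    · rw [h.rootTag, hα _ t.rootTag_mem_tags]
      exact hs.root
    · rcases (h.edge A a B).1 e with e | ⟨rfl, rfl, rfl⟩
      · rw [hα _ (t.edge_mem_tags e).1, hα _ (t.edge_mem_tags e).2]
        exact hs.edge A a B e
      · rw [hα _ hX, Function.update_self]
    · rcases (h.hasSort A s).1 e with e | ⟨rfl, rfl⟩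
      · rw [hα _ (t.mem_tags_of_hasSort e)]
        exact hs.sort A s e
      · rw [I.sort_top]

/-! ### Terms that support given words of features -/

/-- `t.Path w X`: the word `w` leads from the root tag of `t` to `X`. -/
inductive Term.Path (t : Term V S F) : List F → V → Prop
  | nil : t.Path [] t.rootTag
  | snoc {w : List F} {X : V} {f : F} {Y : V} : t.Path w X → t.Edge X f Y → t.Path (w ++ [f]) Y

namespace Term

theorem Path.mono {t t' : Term V S F} (hr : t'.rootTag = t.rootTag)
    (he : ∀ X f Y, t.Edge X f Y → t'.Edge X f Y) {w : List F} {X : V} (h : t.Path w X) :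
    t'.Path w X := by
  induction h with
  | nil => rw [← hr]; exact .nil
  | snoc _ e ih => exact .snoc ih (he _ _ _ e)

theorem Path.mem_tags {t : Term V S F} {w : List F} {X : V} (h : t.Path w X) : X ∈ t.tags := by
  cases h with
  | nil => exact t.rootTag_mem_tags
  | snoc _ e => exact (t.edge_mem_tags e).2

theorem exists_path (t : Term V S F) {X : V} (hX : X ∈ t.tags) : ∃ w, t.Path w X := by
  have := t.reachable_tags hX
  induction this with
  | refl => exact ⟨[], .nil⟩
  | tail _ hf ih =>
    obtain ⟨f, hf⟩ := hf
    obtain ⟨w, hw⟩ := ih (t.edge_mem_tags hf).1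
    exact ⟨w ++ [f], hw.snoc hf⟩

end Term

theorem Satisfies.word_eq {I : Interp L F} {α : V → I.Dom} {b : unitInterval} {t : Term V S F}
    {d : I.Dom} (h : Satisfies I α b t d) {w : List F} {X : V} (hw : t.Path w X) :
    I.word w d = α X := by
  induction hw with
  | nil => exact h.root
  | snoc _ e ih => rw [Interp.word_append, ih, h.edge _ _ _ e]

/-- The word is followed from the root, and a leaf with a tag not yet used is added wherever a
feature is missing. Root and edges are retained so that paths obtained for other words survive. -/
theorem exists_termEquiv_path [Infinite V] (ψ : {t : Term V S F // t.Normal L}) (w : List F) :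
    ∃ ψ' : {t : Term V S F // t.Normal L}, TermEquiv L ψ ψ' ∧ ψ'.1.rootTag = ψ.1.rootTag ∧
      (∀ X f Y, ψ.1.Edge X f Y → ψ'.1.Edge X f Y) ∧ ∃ X, ψ'.1.Path w X := by
  induction w using List.reverseRecOn with
  | nil => exact ⟨ψ, .refl ψ, rfl, fun _ _ _ h => h, _, .nil⟩
  | append_singleton w f ih =>
    obtain ⟨ψ', h1, h2, h3, X, hX⟩ := ih
    by_cases hf : ∃ Y, ψ'.1.Edge X f Y
    · obtain ⟨Y, hY⟩ := hf
      exact ⟨ψ', h1, h2, h3, Y, hX.snoc hY⟩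
    · obtain ⟨Y, hY⟩ := ψ'.1.finite_tags.exists_notMem
      obtain ⟨t', ht'⟩ := ψ'.1.exists_isLeafExtension ψ'.2 hX.mem_tags hY hf
      have hm : ∀ A a B, ψ'.1.Edge A a B → t'.Edge A a B := fun A a B e =>
        (ht'.edge A a B).2 (Or.inl e)
      exact ⟨⟨t', ht'.normal⟩, h1.trans (termEquiv_of_isLeafExtension ψ'.2 hX.mem_tags hY ht'),
        ht'.rootTag.trans h2, fun A a B e => hm A a B (h3 A a B e), Y,
        (hX.mono ht'.rootTag hm).snoc ((ht'.edge _ _ _).2 (Or.inr ⟨rfl, rfl, rfl⟩))⟩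

theorem exists_termEquiv_paths [Infinite V] (ψ : {t : Term V S F // t.Normal L})
    {A : Set (List F)} (hA : A.Finite) :
    ∃ ψ' : {t : Term V S F // t.Normal L}, TermEquiv L ψ ψ' ∧
      ∀ w ∈ A, ∃ X, ψ'.1.Path w X := by
  induction A, hA using Set.Finite.induction_on with
  | empty => exact ⟨ψ, .refl ψ, fun _ h => h.elim⟩
  | @insert w A _ _ ih =>
    obtain ⟨ψ', h, hp⟩ := ih
    obtain ⟨ψ'', h1, h2, h3, hX⟩ := exists_termEquiv_path ψ' w
    refine ⟨ψ'', h.trans h1, ?_⟩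
    rintro u (rfl | hu)
    · exact hX
    · obtain ⟨X, hX⟩ := hp u hu
      exact ⟨X, hX.mono h2 h3⟩

/-! ### Semantic and syntactic subsumption -/

theorem SynSubsumed.semSubsumed {β : unitInterval} {ψ₀ ψ₁ : {t : Term V S F // t.Normal L}}
    (h : SynSubsumed L β ψ₀ ψ₁) : SemSubsumed L β ψ₀ ψ₁ := by
  obtain ⟨h, hroot, hedge, ⟨M, hM⟩, hmin⟩ := h
  -- `k` extends `h` to all of `V`, so that it can be composed with assignments; its values off the
  -- tags do not matter.
  set k : V → V := fun X => if hX : X ∈ ψ₁.1.tags then (h ⟨X, hX⟩).1 else X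
  have hk : ∀ X (hX : X ∈ ψ₁.1.tags), k X = (h ⟨X, hX⟩).1 := fun X hX => dif_pos hX
  have hkr : k ψ₁.1.rootTag = ψ₀.1.rootTag := by
    rw [hk _ ψ₁.1.rootTag_mem_tags, hroot]
  have hke : ∀ X f Y, ψ₁.1.Edge X f Y → ψ₀.1.Edge (k X) f (k Y) := fun X f Y e => by
    rw [hk _ (ψ₁.1.edge_mem_tags e).1, hk _ (ψ₁.1.edge_mem_tags e).2]
    exact hedge _ _ f e
  refine le_antisymm (sSup_le fun b hb => ?_) (le_sSup fun I d => ?_)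
  · rcases eq_or_ne b 0 with rfl | h0
    · exact unitInterval.nonneg'
    have hb0 := unitInterval.pos_iff_ne_zero.2 h0
    have h1 : (1 : unitInterval) ≤ denote (graphAlgebra V L F) ψ₀.1 (ψ₀.1.graph L ψ₀.2) :=
      (le_denote_iff _ zero_lt_one _ _).2 ⟨_, satisfies_graphAt ψ₀.2⟩
    have h2 := (le_min (unitInterval.le_one'.trans h1) le_rfl).trans
      (hb (graphAlgebra V L F) (ψ₀.1.graph L ψ₀.2))
    obtain ⟨α, hα⟩ := (le_denote_iff _ hb0 _ _).1 h2
    -- Degree `0` suffices: this only serves to identify `α` on the tags through `eqOn`. The bound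
    -- on `b` is then read off at the tag `M` attaining the minimum.
    have hs : Satisfies (graphAlgebra V L F) (Term.graphAt ψ₀.2 ∘ k) 0 ψ₁.1
        (ψ₀.1.graph L ψ₀.2) :=
      ⟨((congrArg _ hkr).trans (Term.graphAt_rootTag ψ₀.2)).symm, fun X f Y e =>
        Term.graphFeat_graphAt ψ₀.2 (hke X f Y e), fun _ _ _ => unitInterval.nonneg'⟩
    have h3 := hα.sort M _ (Term.isMostSpecificSort_sortOf ψ₁.2 M.2).1
    rw [hα.eqOn hs M.2] at h3
    change b ≤ L.sub ((Term.graphAt ψ₀.2 (k M)).label (Term.graphAt ψ₀.2 (k M)).root) _ at h3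
    rwa [hk _ M.2, Term.label_root_graphAt ψ₀.2 (h M).2, ← hM] at h3
  · rcases eq_or_ne (min (denote I ψ₀.1 d) β) 0 with h0 | h0
    · rw [h0]; exact unitInterval.nonneg'
    have hpos := unitInterval.pos_iff_ne_zero.2 h0
    obtain ⟨α, hα⟩ := (le_denote_iff I hpos _ _).1 (min_le_left _ _)
    refine (le_denote_iff I hpos _ _).2 ⟨α ∘ k, Satisfies.of_sortOf ψ₁.2 ?_ ?_ fun X hX => ?_⟩
    · rw [Function.comp_apply, hkr]; exact hα.root
    · exact fun X f Y e => hα.edge _ _ _ (hke X f Y e)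
    · rw [Function.comp_apply, hk X hX]
      refine le_trans (le_min ?_ ?_) (I.sort_sub (ψ₀.1.sortOf L (h ⟨X, hX⟩)) _ _)
      · exact hα.sort _ _ (Term.isMostSpecificSort_sortOf ψ₀.2 (h ⟨X, hX⟩).2).1
      · exact (min_le_right _ _).trans (hmin ⟨⟨X, hX⟩, rfl⟩)

theorem SemSubsumed.exists_synSubsumed [Infinite V] {β : unitInterval}
    {ψ₀ ψ₁ : {t : Term V S F // t.Normal L}} (hβ : 0 < β) (h : SemSubsumed L β ψ₀ ψ₁) :
    ∃ ψ₀', TermEquiv L ψ₀ ψ₀' ∧ SynSubsumed L β ψ₀' ψ₁ := by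
  choose w hw using fun X : ψ₁.1.tags => ψ₁.1.exists_path X.2
  have : Finite ψ₁.1.tags := ψ₁.1.finite_tags
  have : Nonempty ψ₁.1.tags := ⟨⟨_, ψ₁.1.rootTag_mem_tags⟩⟩
  -- One word is chosen for each tag of `ψ₁`; only `ψ₀` has to be enlarged.
  obtain ⟨ψ, he, hp⟩ := exists_termEquiv_paths ψ₀ (Set.finite_range w)
  choose k hk using fun X => hp (w X) ⟨X, rfl⟩
  refine ⟨ψ, he, ?_⟩
  have h' : SemSubsumed L β ψ ψ₁ := (he.semSub_eq (.refl ψ₁)).symm.trans h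
  -- Any positive admissible degree is enough to produce the assignment; the degree `β` is recovered
  -- at the end.
  have hα : ∃ c, 0 < c ∧ ∃ α, Satisfies (graphAlgebra V L F) α c ψ₁.1 (ψ.1.graph L ψ.2) := by
    obtain ⟨c, hc, hc0⟩ := lt_sSup_iff.1 (hβ.trans_eq h'.symm)
    have h1 : (1 : unitInterval) ≤ denote (graphAlgebra V L F) ψ.1 (ψ.1.graph L ψ.2) :=
      (le_denote_iff _ zero_lt_one _ _).2 ⟨_, satisfies_graphAt ψ.2⟩
    exact ⟨c, hc0, (le_denote_iff _ hc0 _ _).1 ((le_min (unitInterval.le_one'.trans h1) le_rfl).trans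
      (hc (graphAlgebra V L F) (ψ.1.graph L ψ.2)))⟩
  obtain ⟨c, hc0, α, hα⟩ := hα
  -- Both sides are the value at `G(ψ)` of the word chosen for `X`. This excludes trivial graphs as
  -- values of `α` on tags.
  have hαk : ∀ X : ψ₁.1.tags, α X = Term.graphAt ψ.2 (k X) := fun X =>
    (hα.word_eq (hw X)).symm.trans ((satisfies_graphAt ψ.2).word_eq (hk X))
  have hkt : ∀ X, k X ∈ ψ.1.tags := fun X => (hk X).mem_tags
  have hinj : ∀ A ∈ ψ.1.tags, ∀ B ∈ ψ.1.tags, Term.graphAt ψ.2 A = Term.graphAt ψ.2 B → A = B := by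
    intro A hA B hB e
    have := congrArg OSFGraph.root e
    rw [Term.root_graphAt ψ.2 hA, Term.root_graphAt ψ.2 hB] at this
    cases this
    rfl
  obtain ⟨M, hM⟩ := Finite.exists_min fun X : ψ₁.1.tags =>
    L.sub (ψ.1.sortOf L (k X)) (ψ₁.1.sortOf L X)
  have hsyn : SynSubsumed L (L.sub (ψ.1.sortOf L (k M)) (ψ₁.1.sortOf L M)) ψ ψ₁ := by
    refine ⟨fun X => ⟨k X, hkt X⟩, Subtype.ext ?_, fun X Y f e => ?_, ⟨M, rfl⟩, ?_⟩
    · refine hinj _ (hkt _) _ ψ.1.rootTag_mem_tags ?_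
      rw [← hαk, Term.graphAt_rootTag]
      exact hα.root.symm
    · have h1 : graphFeat f (Term.graphAt ψ.2 (k X)) = Term.graphAt ψ.2 (k Y) := by
        rw [← hαk, ← hαk]; exact hα.edge _ _ _ e
      by_cases hf : ∃ Z, ψ.1.Edge (k X) f Z
      · obtain ⟨Z, hZ⟩ := hf
        rw [Term.graphFeat_graphAt ψ.2 hZ] at h1
        rw [hinj _ (ψ.1.edge_mem_tags hZ).2 _ (hkt Y) h1] at hZ
        exact hZ
      -- Without an edge the feature would give a graph rooted at a new variable, whereas the
      -- right-hand side is rooted at a tag.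
      · rw [Term.graphFeat_graphAt_of_not_edge ψ.2 (hkt X) hf] at h1
        have := congrArg OSFGraph.root h1
        rw [Term.root_graphAt ψ.2 (hkt Y)] at this
        cases this
    · rintro _ ⟨X, rfl⟩
      exact hM X
  -- The semantic degree is a single number, so the minimum just found must equal `β`.
  have := hsyn.semSubsumed.symm.trans h'
  rwa [this] at hsyn

end FuzzyOSF

theorem mainTheorem5 {V S F : Type u} [Countable V] [Infinite V]
    (L : FuzzyOSF.SortLattice S)
    (ψ₀ ψ₁ : {t : FuzzyOSF.Term V S F // t.Normal L})
    (β : unitInterval) (hβ : 0 < β) :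
    FuzzyOSF.SemSubsumed L β ψ₀ ψ₁ ↔
      ∃ ψ₀' ψ₁' : {t : FuzzyOSF.Term V S F // t.Normal L},
        FuzzyOSF.TermEquiv L ψ₀ ψ₀' ∧ FuzzyOSF.TermEquiv L ψ₁ ψ₁' ∧
          FuzzyOSF.SynSubsumed L β ψ₀' ψ₁' := by
  constructor
  · intro h
    obtain ⟨ψ₀', h₀, hs⟩ := h.exists_synSubsumed hβ
    exact ⟨ψ₀', ψ₁, h₀, .refl ψ₁, hs⟩
  · rintro ⟨ψ₀', ψ₁', h₀, h₁, hs⟩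
    exact (h₀.semSub_eq h₁).trans hs.semSubsumed
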